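/- A \emph{Lombardi drawing} of a finite graph maps its vertices to distinct points of the Euclidean plane and each edge to a circular arc or line segment whose endpoints are the points representing the two ends of the edge, so that at every vertex $v$ the arcs of the incident edges leave $v$ in equally spaced directions, consecutive ones forming an angle $2\pi/\deg(v)$. It is \emph{planar} if any two distinct arcs intersect only at points representing vertices shared by the two edges; the arcs of a cycle then form a Jordan curve. \textbf{Theorem.} Let $G$ be the cactus graph consisting of a 3-cycle $v_0v_1v_2$ together with four pendant (degree-one) vertices attached to each of $v_0,v_1,v_2$. Embed $G$ in the plane so that the pendant vertices at $v_0$ and $v_1$ lie outside the 3-cycle and the pendant vertices at $v_2$ lie inside it. This embedded graph has no planar Lombardi drawing; that is, there is no planar Lombardi drawing of $G$ in which the pendant vertices at $v_0$ and $v_1$ lie in the exterior (the unbounded complementary component) of the Jordan curve formed by the three arcs of the cycle while the pendant vertices at $v_2$ lie in its interior (the bounded component). -/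

import Mathlib

/-- A closed circular arc in the Euclidean plane `ℂ`, listed from one endpoint (the source) to the
other (the target): either a nondegenerate line segment, or the arc of the circle with center `c`
and radius `r` traced counterclockwise from the polar angle `a` to the polar angle `b`,
where `a < b < a + 2π`. -/
inductive CircularArc : Type
  | lineSegment (p q : ℂ) (hpq : p ≠ q) : CircularArc
  | circular (c : ℂ) (r a b : ℝ) (hr : 0 < r) (hab : a < b) (hb : b < a + 2 * Real.pi) :
      CircularArc

namespace CircularArc

/-- The set of points of the arc, endpoints included. -/
def carrier : CircularArc → Set ℂ
  | lineSegment p q _ => segment ℝ p q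
  | circular c r a b _ _ _ =>
      (fun t : ℝ => c + (r : ℂ) * Complex.exp ((t : ℂ) * Complex.I)) '' Set.Icc a b

/-- The first endpoint. -/
noncomputable def source : CircularArc → ℂ
  | lineSegment p _ _ => p
  | circular c r a _ _ _ _ => c + (r : ℂ) * Complex.exp ((a : ℂ) * Complex.I)

/-- The second endpoint. -/
noncomputable def target : CircularArc → ℂ
  | lineSegment _ q _ => q
  | circular c r _ b _ _ _ => c + (r : ℂ) * Complex.exp ((b : ℂ) * Complex.I)

/-- The unit tangent vector at the source, pointing into the arc. -/
noncomputable def sourceDir : CircularArc → ℂ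
  | lineSegment p q _ => (q - p) / (‖q - p‖ : ℂ)
  | circular _ _ a _ _ _ _ => Complex.I * Complex.exp ((a : ℂ) * Complex.I)

/-- The unit tangent vector at the target, pointing into the arc. -/
noncomputable def targetDir : CircularArc → ℂ
  | lineSegment p q _ => (p - q) / (‖p - q‖ : ℂ)
  | circular _ _ _ b _ _ _ => -(Complex.I * Complex.exp ((b : ℂ) * Complex.I))

/-- The arc `A` has `x` as an endpoint, and leaves `x` in the direction of the unit vector `u`. -/
def LeavesInDirection (A : CircularArc) (x u : ℂ) : Prop :=
  (x = A.source ∧ u = A.sourceDir) ∨ (x = A.target ∧ u = A.targetDir)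

end CircularArc

/-- A Lombardi drawing of a graph: distinct vertices become distinct points, every edge becomes a
circular arc between the points of its two ends, and at every vertex `v` the arcs of the incident
edges leave in the `deg v` directions `θ + 2πk / deg v`, one arc in each direction. -/
structure LombardiDrawing {V : Type*} (G : SimpleGraph V) [G.LocallyFinite] where
  pos : V → ℂ
  pos_injective : Function.Injective pos
  arc : G.edgeSet → CircularArc
  endpoints : ∀ e : G.edgeSet, s((arc e).source, (arc e).target) = Sym2.map pos (e : Sym2 V)
  equally_spaced : ∀ v : V,
    ∃ (θ : ℝ) (σ : {e : G.edgeSet // v ∈ (e : Sym2 V)} ≃ Fin (G.degree v)),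
      ∀ e : {e : G.edgeSet // v ∈ (e : Sym2 V)},
        (arc e.1).LeavesInDirection (pos v)
          (Complex.exp
            (((θ + 2 * Real.pi * ((σ e : ℕ) : ℝ) / (G.degree v : ℝ) : ℝ) : ℂ) * Complex.I))

namespace LombardiDrawing

variable {V : Type*} {G : SimpleGraph V} [G.LocallyFinite]

/-- The drawing is planar: two different arcs meet only in points of vertices shared by
their edges. -/
def IsPlanar (D : LombardiDrawing G) : Prop :=
  ∀ e f : G.edgeSet, e ≠ f →
    (D.arc e).carrier ∩ (D.arc f).carrier ⊆
      {x | ∃ v : V, v ∈ (e : Sym2 V) ∧ v ∈ (f : Sym2 V) ∧ x = D.pos v}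

end LombardiDrawing

/-- The points inside a closed curve `C`: those off `C` whose connected component in the
complement of `C` is bounded. -/
def insideCurve (C : Set ℂ) : Set ℂ :=
  {z | z ∉ C ∧ Bornology.IsBounded (connectedComponentIn Cᶜ z)}

/-- The points outside a closed curve `C`: those off `C` whose connected component in the
complement of `C` is unbounded. -/
def outsideCurve (C : Set ℂ) : Set ℂ :=
  {z | z ∉ C ∧ ¬ Bornology.IsBounded (connectedComponentIn Cᶜ z)}

/-- Adjacency in the cactus below. The vertex `Sum.inl i` is the `i`-th vertex of the 3-cycle,
and `Sum.inr (i, k)` is the `k`-th pendant vertex attached to it. -/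
def hatAdj : Fin 3 ⊕ (Fin 3 × Fin 4) → Fin 3 ⊕ (Fin 3 × Fin 4) → Prop
  | Sum.inl i, Sum.inl j => i ≠ j
  | Sum.inl i, Sum.inr (j, _) => i = j
  | Sum.inr (i, _), Sum.inl j => i = j
  | Sum.inr _, Sum.inr _ => False

instance hatAdj_decidable : DecidableRel hatAdj
  | Sum.inl i, Sum.inl j => inferInstanceAs (Decidable (i ≠ j))
  | Sum.inl i, Sum.inr (j, _) => inferInstanceAs (Decidable (i = j))
  | Sum.inr (i, _), Sum.inl j => inferInstanceAs (Decidable (i = j))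
  | Sum.inr _, Sum.inr _ => inferInstanceAs (Decidable False)

/-- The cactus made of a 3-cycle with four pendant vertices at each of its vertices. -/
def hatCactus : SimpleGraph (Fin 3 ⊕ (Fin 3 × Fin 4)) where
  Adj := hatAdj
  symm := ⟨by
    rintro (i | ⟨i, k⟩) (j | ⟨j, l⟩) h
    · exact Ne.symm h
    · exact Eq.symm h
    · exact Eq.symm h
    · exact h⟩
  loopless := ⟨by
    rintro (i | ⟨i, k⟩) h
    · exact h rfl
    · exact h⟩

instance hatCactus_decidable : DecidableRel hatCactus.Adj :=
  inferInstanceAs (DecidableRel hatAdj)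

namespace LombardiDrawing

/-- The closed curve drawn for the 3-cycle: the union of the arcs of the edges both of whose ends
are cycle vertices. -/
def cycleCurve (D : LombardiDrawing hatCactus) : Set ℂ :=
  ⋃ e ∈ {e : hatCactus.edgeSet |
      ∀ v ∈ (e : Sym2 (Fin 3 ⊕ (Fin 3 × Fin 4))), ∃ i : Fin 3, v = Sum.inl i},
    (D.arc e).carrier

/-- The drawing has the prescribed embedding: the pendant vertices at the cycle vertices `0` and `1`
lie outside the 3-cycle, those at the cycle vertex `2` lie inside. -/
def HasBadHatEmbedding (D : LombardiDrawing hatCactus) : Prop :=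
  (∀ k : Fin 4, D.pos (Sum.inr (0, k)) ∈ outsideCurve D.cycleCurve) ∧
  (∀ k : Fin 4, D.pos (Sum.inr (1, k)) ∈ outsideCurve D.cycleCurve) ∧
  (∀ k : Fin 4, D.pos (Sum.inr (2, k)) ∈ insideCurve D.cycleCurve)

end LombardiDrawing

/-!
An arc from `p` to `q` is recorded by one complex number `w` off the non-positive real axis: it is
the set of points `(p + s w q) / (1 + s w)`, `0 ≤ s ≤ ∞`, that is, of the points `z` for which
`(z - p) / ((q - z) w)` is a non-negative real number or infinite. It leaves `p` in the direction
`w (q - p)` and `q` in the direction `w⁻¹ (p - q)`, and the arcs from `p` to `q` that make a small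
angle `φ` with it belong to `w e^{iφ}`. Every segment and every circular arc has this form
(`CircularArc.exists_moebiusArc`).

Let `w₀, w₁, w₂` belong to the arcs of the 3-cycle on `v₀, v₁, v₂`. All vertex angles are multiples
of `π/3`. The topological half of the argument shows that the angles between the two cycle arcs,
all measured from the outgoing to the incoming arc, are `π/3, π/3, 5π/3` at `v₀, v₁, v₂`, or their
negatives. It needs the following part of the Jordan curve theorem for the cycle.

* All pendant arcs that leave the cycle to its left end in one component of the complement, and so
  do those that leave to its right. Indeed, for small `φ > 0` the open arcs of `w_i e^{iφ}` avoid
  the cycle (`ArcTriangle.eventually_lens_subset`), and at a vertex any two arcs leaving inside the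
  same sector are joined by a small circular sector that avoids the cycle
  (`exists_isPreconnected_of_sectorAvoids`). The right side is the left side of the reversed cycle.
* The two sides do not both lie in unbounded components. The square root of the product of the
  `-(z - v_i) / ((v_{i+1} - z) w_i)` obtained from principal logarithms is continuous off the cycle
  and has constant square, so it is constant on components; on unbounded ones it equals its limit at
  infinity, and it changes sign across the arc from `v₀` to `v₁`
  (`ArcTriangle.not_eventually_windingSign_eq`).

Hence at `v₀` and `v₁` all pendant arcs are on the same side of the cycle, and at `v₂` they are all
on the other side, which gives the angles.

The algebraic half is `exists_crossing`. The three angle conditions multiply to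
`w₀² = k² ((v₂ - v₀) / (v₁ - v₂))²` with `k > 0`. If `w₀` is the root with the sign `+`, then `v₂`
lies on the arc from `v₀` to `v₁`. If it is the one with the sign `-`, then the arcs from `v₁` to
`v₂` and from `v₂` to `v₀` cross in a point other than `v₂`. Neither happens in a planar drawing.
-/

open Complex Set Filter Topology

/-! ### Arcs through a Möbius parameter -/

/-- The negative of `(z - p) / ((q - z) w)`, so that the principal branch of the logarithm is
available off the arc from `p` to `q` with parameter `w`. At `z = q` the division by zero makes it
`0`. -/
noncomputable def arcRatio (p q w z : ℂ) : ℂ := -((z - p) / ((q - z) * w))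

/-- The closed arc from `p` to `q` with parameter `w`: the points where `(z - p) / ((q - z) w)` is a
non-negative real number. The point `q` belongs to it by the convention `x / 0 = 0`. -/
def moebiusArc (p q w : ℂ) : Set ℂ := {z | arcRatio p q w z ∉ slitPlane}

/-- The point of the arc from `p` to `q` with parameter `w` at which `(z - p) / ((q - z) w)` equals
`s`. -/
noncomputable def arcPoint (p q w : ℂ) (s : ℝ) : ℂ := (p + s * w * q) / (1 + s * w)

/-- The arc from `p` to `q` with parameter `w`, without its endpoints. -/
def openArc (p q w : ℂ) : Set ℂ := arcPoint p q w '' Ioi 0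

theorem one_add_mul_ne_zero {w : ℂ} (hw : w ∈ slitPlane) {s : ℝ} (hs : 0 ≤ s) :
    1 + (s : ℂ) * w ≠ 0 := by
  intro h
  rw [mem_slitPlane_iff] at hw
  have h1 := congrArg re h
  have h2 := congrArg im h
  simp at h1 h2
  rcases hw with hw | hw
  · nlinarith [mul_nonneg hs hw.le]
  · rcases h2 with h2 | h2
    · simp [h2] at h1
    · exact hw h2

theorem arcPoint_sub_source {p q w : ℂ} (hw : w ∈ slitPlane) {s : ℝ} (hs : 0 ≤ s) :
    arcPoint p q w s - p = s * (w * (q - p)) / (1 + s * w) := by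
  have := one_add_mul_ne_zero hw hs
  unfold arcPoint
  field_simp
  ring

theorem target_sub_arcPoint {p q w : ℂ} (hw : w ∈ slitPlane) {s : ℝ} (hs : 0 ≤ s) :
    q - arcPoint p q w s = (q - p) / (1 + s * w) := by
  have := one_add_mul_ne_zero hw hs
  unfold arcPoint
  field_simp
  ring

/-- Seen from the arc with parameter `w`, the points of the arc with parameter `w * c` have their
ratio on a fixed ray. -/
theorem arcRatio_arcPoint {p q w c : ℂ} (hpq : p ≠ q) (hw : w ≠ 0) (hc : w * c ∈ slitPlane)
    {s : ℝ} (hs : 0 ≤ s) : arcRatio p q w (arcPoint p q (w * c) s) = -(s * c) := by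
  have h1 := one_add_mul_ne_zero hc hs
  have h2 : q - p ≠ 0 := sub_ne_zero.2 hpq.symm
  rw [arcRatio, arcPoint_sub_source hc hs, target_sub_arcPoint hc hs, neg_inj,
    div_eq_iff (mul_ne_zero (div_ne_zero h2 h1) hw)]
  ring

theorem arcRatio_ne_zero {p q w z : ℂ} (hw : w ≠ 0) (hp : z ≠ p) (hq : z ≠ q) :
    arcRatio p q w z ≠ 0 := by
  have h1 := sub_ne_zero.2 hp
  have h2 := sub_ne_zero.2 hq.symm
  simp [arcRatio, h1, h2, hw]

theorem notMem_slitPlane_iff {z : ℂ} : z ∉ slitPlane ↔ ∃ s : ℝ, 0 ≤ s ∧ z = -s := by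
  rw [mem_slitPlane_iff]
  push Not
  constructor
  · rintro ⟨h1, h2⟩
    exact ⟨-z.re, by linarith, by apply Complex.ext <;> simp [h2]⟩
  · rintro ⟨s, hs, rfl⟩
    simp [hs]

theorem eq_arcPoint_of_sub_eq {p q w z : ℂ} (hw : w ∈ slitPlane) {s : ℝ} (hs : 0 ≤ s)
    (h : z - p = s * w * (q - z)) : z = arcPoint p q w s := by
  rw [arcPoint, eq_div_iff (one_add_mul_ne_zero hw hs)]
  linear_combination h

theorem mem_moebiusArc_iff {p q w z : ℂ} (hpq : p ≠ q) (hw : w ∈ slitPlane) :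
    z ∈ moebiusArc p q w ↔ z = p ∨ z = q ∨ z ∈ openArc p q w := by
  have hw0 := slitPlane_ne_zero hw
  constructor
  · intro h
    by_cases hp : z = p
    · exact Or.inl hp
    by_cases hq : z = q
    · exact Or.inr (Or.inl hq)
    refine Or.inr (Or.inr ?_)
    obtain ⟨s, hs, h⟩ := notMem_slitPlane_iff.1 h
    have hs' : s ≠ 0 := by
      rintro rfl
      exact arcRatio_ne_zero hw0 hp hq (by simpa using h)
    refine ⟨s, lt_of_le_of_ne hs hs'.symm, (eq_arcPoint_of_sub_eq hw hs ?_).symm⟩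
    have h2 : q - z ≠ 0 := sub_ne_zero.2 (Ne.symm hq)
    rw [arcRatio, neg_inj, div_eq_iff (mul_ne_zero h2 hw0)] at h
    linear_combination h
  · rintro (rfl | rfl | ⟨s, hs, rfl⟩)
    · simp [moebiusArc, arcRatio]
    · simp [moebiusArc, arcRatio]
    · have := arcRatio_arcPoint (c := 1) hpq hw0 (by simpa using hw) (le_of_lt hs)
      simp only [mul_one] at this
      rw [moebiusArc, mem_ofPred_eq, this, notMem_slitPlane_iff]
      exact ⟨s, le_of_lt hs, rfl⟩

theorem source_mem_moebiusArc (p q w : ℂ) : p ∈ moebiusArc p q w := by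
  simp [moebiusArc, arcRatio]

theorem target_mem_moebiusArc (p q w : ℂ) : q ∈ moebiusArc p q w := by
  simp [moebiusArc, arcRatio]

theorem ne_of_mem_openArc {p q w z : ℂ} (hpq : p ≠ q) (hw : w ∈ slitPlane)
    (hz : z ∈ openArc p q w) : z ≠ p ∧ z ≠ q := by
  obtain ⟨s, hs, rfl⟩ := hz
  have h1 := one_add_mul_ne_zero hw (le_of_lt hs)
  have h0 := slitPlane_ne_zero hw
  have h2 : q - p ≠ 0 := sub_ne_zero.2 hpq.symm
  have h3 : (s : ℂ) ≠ 0 := by exact_mod_cast (ne_of_gt hs)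
  refine ⟨sub_ne_zero.1 ?_, (sub_ne_zero.1 ?_).symm⟩
  · rw [arcPoint_sub_source hw (le_of_lt hs)]
    exact div_ne_zero (mul_ne_zero h3 (mul_ne_zero h0 h2)) h1
  · rw [target_sub_arcPoint hw (le_of_lt hs)]
    exact div_ne_zero h2 h1

theorem inv_mem_slitPlane_iff {z : ℂ} : z⁻¹ ∈ slitPlane ↔ z ∈ slitPlane := by
  rw [← not_iff_not, notMem_slitPlane_iff, notMem_slitPlane_iff]
  constructor
  · rintro ⟨s, hs, h⟩
    exact ⟨s⁻¹, inv_nonneg.2 hs, by rw [← inv_inv z, h]; push_cast; rw [inv_neg]⟩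
  · rintro ⟨s, hs, h⟩
    exact ⟨s⁻¹, inv_nonneg.2 hs, by rw [h]; push_cast; rw [inv_neg]⟩

theorem arcRatio_reverse (p q w z : ℂ) : arcRatio q p w⁻¹ z = (arcRatio p q w z)⁻¹ := by
  have h : z - q = -(q - z) := by ring
  have h' : p - z = -(z - p) := by ring
  rw [arcRatio, arcRatio, h, h', inv_neg, inv_div, neg_mul, neg_div_neg_eq, div_mul_eq_div_div,
    div_inv_eq_mul, div_mul_eq_mul_div]

theorem moebiusArc_reverse (p q w : ℂ) : moebiusArc q p w⁻¹ = moebiusArc p q w := by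
  ext z
  rw [moebiusArc, moebiusArc, mem_ofPred_eq, mem_ofPred_eq, arcRatio_reverse, inv_mem_slitPlane_iff]

theorem arcPoint_reverse {p q w : ℂ} (hw : w ∈ slitPlane) {s : ℝ} (hs : 0 < s) :
    arcPoint q p w⁻¹ s⁻¹ = arcPoint p q w s := by
  have h0 := slitPlane_ne_zero hw
  have h1 := one_add_mul_ne_zero hw hs.le
  have h2 : (s : ℂ) ≠ 0 := by exact_mod_cast hs.ne'
  have h3 := one_add_mul_ne_zero (inv_mem_slitPlane_iff.2 hw) (inv_nonneg.2 hs.le)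
  rw [arcPoint, arcPoint, div_eq_div_iff h3 h1]
  push_cast
  field_simp
  ring

theorem openArc_reverse {p q w : ℂ} (hw : w ∈ slitPlane) : openArc q p w⁻¹ = openArc p q w := by
  ext z
  constructor
  · rintro ⟨s, hs, rfl⟩
    refine ⟨s⁻¹, mem_Ioi.2 (inv_pos.2 hs), ?_⟩
    rw [← arcPoint_reverse hw (inv_pos.2 hs), inv_inv]
  · rintro ⟨s, hs, rfl⟩
    exact ⟨s⁻¹, mem_Ioi.2 (inv_pos.2 hs), arcPoint_reverse hw hs⟩

theorem continuousAt_arcRatio {p q w z : ℂ} (hw : w ≠ 0) (hz : z ≠ q) :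
    ContinuousAt (arcRatio p q w) z := by
  have : (q - z) * w ≠ 0 := mul_ne_zero (sub_ne_zero.2 hz.symm) hw
  unfold arcRatio
  fun_prop (disch := assumption)

theorem continuousAt_arcRatio_of_notMem {p q w z : ℂ} (hw : w ≠ 0) (hz : z ∉ moebiusArc p q w) :
    ContinuousAt (arcRatio p q w) z :=
  continuousAt_arcRatio hw (by rintro rfl; exact hz (target_mem_moebiusArc _ _ _))

theorem isClosed_moebiusArc {p q w : ℂ} (hw : w ≠ 0) : IsClosed (moebiusArc p q w) := by
  rw [← isOpen_compl_iff, isOpen_iff_mem_nhds]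
  intro z hz
  have h1 : arcRatio p q w z ∈ slitPlane := not_not.1 hz
  filter_upwards [(continuousAt_arcRatio_of_notMem hw hz).preimage_mem_nhds
    (isOpen_slitPlane.mem_nhds h1)] with y hy
  exact not_not.2 hy

theorem continuousOn_arcPoint {p q w : ℂ} (hw : w ∈ slitPlane) :
    ContinuousOn (arcPoint p q w) (Ici 0) := by
  unfold arcPoint
  refine ContinuousOn.div (by fun_prop) (by fun_prop) fun s hs => one_add_mul_ne_zero hw hs

theorem isPreconnected_openArc {p q w : ℂ} (hw : w ∈ slitPlane) :
    IsPreconnected (openArc p q w) :=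
  isPreconnected_Ioi.image _ ((continuousOn_arcPoint hw).mono Ioi_subset_Ici_self)

theorem source_mem_closure_openArc {p q w : ℂ} (hw : w ∈ slitPlane) :
    p ∈ closure (openArc p q w) := by
  have h : Tendsto (arcPoint p q w) (𝓝[>] 0) (𝓝 (arcPoint p q w 0)) :=
    ((continuousOn_arcPoint hw) 0 self_mem_Ici).mono_left (nhdsWithin_mono _ Ioi_subset_Ici_self)
  have h0 : arcPoint p q w 0 = p := by simp [arcPoint]
  rw [h0] at h
  refine mem_closure_of_tendsto h ?_
  filter_upwards [self_mem_nhdsWithin] with s hs using mem_image_of_mem _ hs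

theorem target_mem_closure_openArc {p q w : ℂ} (hw : w ∈ slitPlane) :
    q ∈ closure (openArc p q w) := by
  rw [← openArc_reverse hw]
  exact source_mem_closure_openArc (inv_mem_slitPlane_iff.2 hw)

/-! ### Sectors at a vertex -/

theorem ofReal_mul_mem_slitPlane {r : ℝ} (hr : 0 < r) {z : ℂ} :
    (r : ℂ) * z ∈ slitPlane ↔ z ∈ slitPlane := by
  simp [mem_slitPlane_iff, hr, hr.ne']

theorem neg_exp_mul_I_mem_slitPlane {x : ℝ} (h0 : x ≠ 0) (h1 : -(2 * Real.pi) < x)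
    (h2 : x < 2 * Real.pi) : -exp (x * I) ∈ slitPlane := by
  by_contra h
  obtain ⟨s, hs, h⟩ := notMem_slitPlane_iff.1 h
  rw [neg_inj] at h
  have h3 := congrArg norm h
  rw [norm_exp_ofReal_mul_I, norm_real, Real.norm_of_nonneg hs] at h3
  have h4 := congrArg re h
  rw [exp_ofReal_mul_I_re, ofReal_re, ← h3] at h4
  exact h0 ((Real.cos_eq_one_iff_of_lt_of_lt h1 h2).1 h4)

/-- Near `v`, an arc that leaves `v` at the angle `θ` to the direction `a` avoids every closed
sector whose angles to `a` do not include `θ`. -/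
theorem eventually_ray_notMem_moebiusArc {v q w a : ℂ} {x θ θ₁ θ₂ : ℝ} (hvq : v ≠ q)
    (hw : w ∈ slitPlane) (hdir : w * (q - v) = a * exp (x + θ * I))
    (hθ : ∀ ψ ∈ Icc θ₁ θ₂, ψ - θ ≠ 0 ∧ -(2 * Real.pi) < ψ - θ ∧ ψ - θ < 2 * Real.pi) :
    ∀ᶠ r : ℝ in 𝓝[>] 0, ∀ ψ ∈ Icc θ₁ θ₂, v + r * (a * exp ((ψ : ℂ) * I)) ∉ moebiusArc v q w := by
  have hw0 := slitPlane_ne_zero hw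
  have hqv : q - v ≠ 0 := sub_ne_zero.2 hvq.symm
  have ha : a ≠ 0 := by
    rintro rfl
    exact mul_ne_zero hw0 hqv (by simpa using hdir)
  -- This is `arcRatio` divided by the radius `r`, which makes sense at `r = 0` too.
  have key : ∀ᶠ r : ℝ in 𝓝 0, ∀ ψ ∈ Icc θ₁ θ₂,
      -(a * exp ((ψ : ℂ) * I) / ((q - v - r * (a * exp ((ψ : ℂ) * I))) * w)) ∈ slitPlane := by
    refine isCompact_Icc.eventually_forall_of_forall_eventually fun ψ hψ => ?_
    have hc : ContinuousAt (fun y : ℝ × ℝ =>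
        -(a * exp ((y.2 : ℂ) * I) / ((q - v - y.1 * (a * exp ((y.2 : ℂ) * I))) * w))) (0, ψ) := by
      have : (q - v - ((0 : ℝ) : ℂ) * (a * exp ((ψ : ℂ) * I))) * w ≠ 0 := by simp [hw0, hqv]
      fun_prop (disch := assumption)
    refine hc.preimage_mem_nhds (isOpen_slitPlane.mem_nhds ?_)
    obtain ⟨h0, h1, h2⟩ := hθ ψ hψ
    have h3 := neg_exp_mul_I_mem_slitPlane h0 h1 h2
    rw [← ofReal_mul_mem_slitPlane (Real.exp_pos (-x))] at h3
    convert h3 using 1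
    have h4 : (q - v) * w = a * exp (x + θ * I) := by rw [← hdir]; ring
    simp only [ofReal_zero, zero_mul, sub_zero, h4]
    rw [mul_div_mul_left _ _ ha, ← exp_sub, ofReal_exp, mul_neg, ← exp_add]
    congr 2
    push_cast
    ring
  filter_upwards [nhdsWithin_le_nhds key, self_mem_nhdsWithin] with r hr hr0 ψ hψ
  have h := (ofReal_mul_mem_slitPlane (mem_Ioi.1 hr0)).2 (hr ψ hψ)
  refine not_not_intro ?_
  convert h using 1
  rw [arcRatio]
  rw [mul_neg, mul_div_assoc', add_sub_cancel_left, sub_add_eq_sub_sub]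

theorem eventually_ray_notMem_of_isClosed {v a : ℂ} {K : Set ℂ} (hK : IsClosed K) (hv : v ∉ K)
    (θ₁ θ₂ : ℝ) :
    ∀ᶠ r : ℝ in 𝓝[>] 0, ∀ ψ ∈ Icc θ₁ θ₂, v + r * (a * exp ((ψ : ℂ) * I)) ∉ K := by
  refine nhdsWithin_le_nhds ?_
  refine isCompact_Icc.eventually_forall_of_forall_eventually fun ψ _ => ?_
  have hc : ContinuousAt (fun y : ℝ × ℝ => v + y.1 * (a * exp ((y.2 : ℂ) * I))) (0, ψ) := by
    fun_prop
  exact hc.preimage_mem_nhds (hK.isOpen_compl.mem_nhds (by simpa using hv))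

/-- Every closed subsector of the open sector at `v` between the angles `0` and `θ`, measured
counterclockwise from the direction `a`, avoids `C` near `v`. -/
def SectorAvoids (C : Set ℂ) (v a : ℂ) (θ : ℝ) : Prop :=
  ∀ θ₁ θ₂ : ℝ, 0 < θ₁ → θ₂ < θ →
    ∀ᶠ r : ℝ in 𝓝[>] 0, ∀ ψ ∈ Icc θ₁ θ₂, v + r * (a * exp ((ψ : ℂ) * I)) ∉ C

/-- The open circular sector at `v` of radius `‖a‖ e ^ R`, between the angles `θ₁` and `θ₂` measured
from the direction `a`, without `v`. It is written as the image of a convex set under the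
exponential function, which shows that it is connected. -/
def sector (v a : ℂ) (R θ₁ θ₂ : ℝ) : Set ℂ := (fun ζ => v + a * exp ζ) '' (Iio R ×ℂ Ioo θ₁ θ₂)

theorem isPreconnected_sector (v a : ℂ) (R θ₁ θ₂ : ℝ) : IsPreconnected (sector v a R θ₁ θ₂) := by
  refine IsPreconnected.image ?_ _ (by fun_prop)
  exact (Convex.inter ((convex_Iio R).linear_preimage reLm)
    ((convex_Ioo θ₁ θ₂).linear_preimage imLm)).isPreconnected

theorem openArc_inter_sector_nonempty {v q w a : ℂ} {x ψ R θ₁ θ₂ : ℝ} (hw : w ∈ slitPlane)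
    (hdir : w * (q - v) = a * exp (x + ψ * I)) (h₁ : θ₁ < ψ) (h₂ : ψ < θ₂) :
    (openArc v q w ∩ sector v a R θ₁ θ₂).Nonempty := by
  have hlog : Tendsto (fun s : ℝ => log (1 + s * w)) (𝓝[>] 0) (𝓝 0) := by
    have : ContinuousAt (fun s : ℝ => log (1 + s * w)) 0 := by
      have h1 : 1 + ((0 : ℝ) : ℂ) * w ∈ slitPlane := by simp
      exact ContinuousAt.clog (by fun_prop) h1
    have h2 := this.tendsto
    simp only [ofReal_zero, zero_mul, add_zero, log_one] at h2
    exact h2.mono_left nhdsWithin_le_nhds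
  have hre : Tendsto (fun s : ℝ => Real.log s + (x - (log (1 + s * w)).re)) (𝓝[>] 0) atBot := by
    refine Real.tendsto_log_nhdsGT_zero.atBot_add (C := x - (0 : ℂ).re) ?_
    exact tendsto_const_nhds.sub ((continuous_re.tendsto _).comp hlog)
  have him : Tendsto (fun s : ℝ => ψ - (log (1 + s * w)).im) (𝓝[>] 0) (𝓝 ψ) := by
    have := (tendsto_const_nhds (x := ψ)).sub ((continuous_im.tendsto _).comp hlog)
    simpa using this
  have h := ((hre.eventually (eventually_lt_atBot R)).and
    ((him.eventually (lt_mem_nhds h₁)).and (him.eventually (gt_mem_nhds h₂)))).and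
      (self_mem_nhdsWithin (s := Ioi (0 : ℝ)))
  obtain ⟨s, ⟨hs1, hs2, hs3⟩, hs⟩ := h.exists
  have hs : 0 < s := hs
  have hne := one_add_mul_ne_zero hw hs.le
  refine ⟨arcPoint v q w s, mem_image_of_mem _ hs,
    Real.log s + (x + ψ * I) - log (1 + s * w), ?_, ?_⟩
  · rw [mem_reProdIm]
    constructor
    · simp only [sub_re, add_re, ofReal_re, mul_re, I_re, mul_zero, ofReal_im, I_im, mul_one,
        sub_self, add_zero, mem_Iio]
      linarith
    · simpa using ⟨hs2, hs3⟩
  · have h5 := arcPoint_sub_source (p := v) (q := q) hw hs.le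
    rw [hdir] at h5
    simp only
    rw [exp_sub, exp_log hne, exp_add, ← ofReal_exp, Real.exp_log hs, eq_comm,
      ← sub_eq_iff_eq_add', h5]
    ring

/-- Two arcs that leave `v` inside the same sector and avoid `C` are joined by a connected set that
avoids `C`: add a small circular sector at `v` to them. -/
theorem exists_isPreconnected_of_sectorAvoids {C : Set ℂ} {v a q w q' w' : ℂ}
    {θ x ψ x' ψ' : ℝ} (hC : SectorAvoids C v a θ) (hw : w ∈ slitPlane) (hw' : w' ∈ slitPlane)
    (hdir : w * (q - v) = a * exp (x + ψ * I)) (hdir' : w' * (q' - v) = a * exp (x' + ψ' * I))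
    (hψ : ψ ∈ Ioo 0 θ) (hψ' : ψ' ∈ Ioo 0 θ)
    (hA : openArc v q w ⊆ Cᶜ) (hA' : openArc v q' w' ⊆ Cᶜ) :
    ∃ S, IsPreconnected S ∧ S ⊆ Cᶜ ∧ openArc v q w ⊆ S ∧ openArc v q' w' ⊆ S := by
  obtain ⟨θ₁, h1, h1'⟩ := exists_between (lt_min hψ.1 hψ'.1)
  obtain ⟨θ₂, h2, h2'⟩ := exists_between (max_lt hψ.2 hψ'.2)
  rw [lt_min_iff] at h1'
  rw [max_lt_iff] at h2
  obtain ⟨ρ, hρ, hρC⟩ := (mem_nhdsGT_iff_exists_Ioo_subset).1 (hC θ₁ θ₂ h1 h2')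
  have hρ : 0 < ρ := hρ
  have hT : sector v a (Real.log ρ) θ₁ θ₂ ⊆ Cᶜ := by
    rintro _ ⟨ζ, hζ, rfl⟩
    rw [mem_reProdIm] at hζ
    have h3 : Real.exp ζ.re ∈ Ioo 0 ρ := ⟨Real.exp_pos _, (Real.lt_log_iff_exp_lt hρ).1 hζ.1⟩
    have h4 := hρC h3 ζ.im ⟨hζ.2.1.le, hζ.2.2.le⟩
    convert h4 using 2
    simp only
    conv_lhs => rw [← re_add_im ζ, exp_add, ← ofReal_exp]
    ring
  obtain ⟨y, hy, hy'⟩ := openArc_inter_sector_nonempty (R := Real.log ρ) hw hdir h1'.1 h2.1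
  obtain ⟨z, hz, hz'⟩ := openArc_inter_sector_nonempty (R := Real.log ρ) hw' hdir' h1'.2 h2.2
  refine ⟨openArc v q w ∪ sector v a (Real.log ρ) θ₁ θ₂ ∪ openArc v q' w', ?_, ?_, ?_, ?_⟩
  · refine IsPreconnected.union z (Or.inr hz') hz ?_ (isPreconnected_openArc hw')
    exact IsPreconnected.union y hy hy' (isPreconnected_openArc hw)
      (isPreconnected_sector v a _ θ₁ θ₂)
  · exact union_subset (union_subset hA hT) hA'
  · exact fun _ h => Or.inl (Or.inl h)
  · exact fun _ h => Or.inr h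

/-! ### Arcs at a small angle to a given arc -/

theorem eventually_mul_exp_mem_slitPlane {w : ℂ} (hw : w ∈ slitPlane) :
    ∀ᶠ φ : ℝ in 𝓝 0, w * exp (φ * I) ∈ slitPlane := by
  have hc : ContinuousAt (fun φ : ℝ => w * exp (φ * I)) 0 := by fun_prop
  exact hc.preimage_mem_nhds (isOpen_slitPlane.mem_nhds (by simpa using hw))

theorem notMem_moebiusArc_of_mem_openArc_mul_exp {p q w z : ℂ} {φ : ℝ} (hpq : p ≠ q)
    (hw : w ∈ slitPlane) (hwφ : w * exp (φ * I) ∈ slitPlane) (h0 : φ ≠ 0)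
    (h1 : -(2 * Real.pi) < φ) (h2 : φ < 2 * Real.pi) (hz : z ∈ openArc p q (w * exp (φ * I))) :
    z ∉ moebiusArc p q w := by
  obtain ⟨s, hs, rfl⟩ := hz
  refine not_not_intro ?_
  rw [arcRatio_arcPoint hpq (slitPlane_ne_zero hw) hwφ (le_of_lt hs), ← mul_neg,
    ofReal_mul_mem_slitPlane hs]
  exact neg_exp_mul_I_mem_slitPlane h0 h1 h2

/-- For an arc from `p` to `q` with parameter `w` and an arc from `q` to `r` with parameter `w'`:
`t` times the value of `arcRatio p q w` at the point of the second arc with parameter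
`s = t / (1 - t)`. The factor `t` removes the pole at `q`, so that this function is continuous on
all of `[0, 1]`; at `t = 0` it compares the directions of the two arcs at `q`. -/
noncomputable def adjacentRatio (p q r w w' : ℂ) (t : ℝ) : ℂ :=
  -(((1 - t) * (q - p) + t * (w' * (r - p))) / (w * (w' * (q - r))))

theorem mul_arcRatio_arcPoint_adjacent {p q r w w' : ℂ} (hqr : q ≠ r) (hw : w ≠ 0)
    (hw' : w' ∈ slitPlane) {s : ℝ} (hs : 0 < s) :
    ((s / (1 + s) : ℝ) : ℂ) * arcRatio p q w (arcPoint q r w' s) =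
      adjacentRatio p q r w w' (s / (1 + s)) := by
  have h1 := one_add_mul_ne_zero hw' hs.le
  have h2 := slitPlane_ne_zero hw'
  have h3 : q - r ≠ 0 := sub_ne_zero.2 hqr
  have h4 : (s : ℂ) ≠ 0 := by exact_mod_cast hs.ne'
  have h5 : (1 + s : ℂ) ≠ 0 := by exact_mod_cast (by positivity : (1 + s : ℝ) ≠ 0)
  have h6 : q - arcPoint q r w' s = s * w' * (q - r) / (1 + s * w') := by
    rw [arcPoint]
    field_simp
    ring
  have h7 : arcPoint q r w' s - p = (q - p + s * (w' * (r - p))) / (1 + s * w') := by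
    rw [arcPoint]
    field_simp
    ring
  rw [arcRatio, adjacentRatio, h6, h7, mul_neg, neg_inj, div_mul_eq_mul_div,
    div_div_div_cancel_right₀ h1, mul_div_assoc',
    div_eq_div_iff (by simp [h4, h2, h3, hw]) (by simp [h2, h3, hw])]
  push_cast
  field_simp
  ring

theorem arcRatio_target_adjacent {p q r w w' : ℂ} (hw' : w' ≠ 0) :
    arcRatio p q w r = adjacentRatio p q r w w' 1 := by
  rw [arcRatio, adjacentRatio]
  simp only [ofReal_one, sub_self, zero_mul, zero_add, one_mul]
  rw [mul_left_comm, mul_div_mul_left _ _ hw', mul_comm w]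

/-- Turning an arc from `p` to `q` by a small angle keeps it away from an arc from `q` to `r`, if
the two arcs meet only in `q` and leave `q` in different directions. -/
theorem eventually_openArc_mul_exp_avoids_adjacent {p q r w w' : ℂ} {x θ : ℝ}
    (hpq : p ≠ q) (hqr : q ≠ r) (hw : w ∈ slitPlane) (hw' : w' ∈ slitPlane)
    (hdisj : moebiusArc p q w ∩ moebiusArc q r w' ⊆ {q})
    (hdir : w⁻¹ * (p - q) = w' * (r - q) * exp (x + θ * I)) (hθ : θ ∈ Ioo 0 (2 * Real.pi)) :
    ∀ᶠ φ : ℝ in 𝓝 0, ∀ z ∈ openArc p q (w * exp (φ * I)), z ∉ moebiusArc q r w' := by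
  have hw0 := slitPlane_ne_zero hw
  have hw0' := slitPlane_ne_zero hw'
  have hmem : ∀ t ∈ Icc (0 : ℝ) 1, adjacentRatio p q r w w' t ∈ slitPlane := by
    intro t ht
    rcases ht.1.eq_or_lt with rfl | ht0
    · have h3 := neg_exp_mul_I_mem_slitPlane hθ.1.ne' (by linarith [hθ.1, Real.pi_pos]) hθ.2
      rw [← ofReal_mul_mem_slitPlane (Real.exp_pos x), ofReal_exp, mul_neg, ← exp_add] at h3
      convert h3 using 1
      have h5 : q - r ≠ 0 := sub_ne_zero.2 hqr
      rw [adjacentRatio, neg_inj, div_eq_iff (by simp [hw0, hw0', h5])]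
      rw [inv_mul_eq_iff_eq_mul₀ hw0] at hdir
      simp only [ofReal_zero]
      linear_combination -hdir
    rcases ht.2.eq_or_lt with rfl | ht1
    · rw [← arcRatio_target_adjacent hw0']
      by_contra h
      exact hqr.symm (hdisj ⟨h, target_mem_moebiusArc _ _ _⟩)
    · have hs : 0 < t / (1 - t) := div_pos ht0 (by linarith)
      have hst : t / (1 - t) / (1 + t / (1 - t)) = t := by
        have : 1 - t ≠ 0 := by linarith
        field_simp
        ring
      have h := mul_arcRatio_arcPoint_adjacent (p := p) hqr hw0 hw' hs
      rw [hst] at h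
      rw [← h, ofReal_mul_mem_slitPlane ht0]
      by_contra h'
      have hz : arcPoint q r w' (t / (1 - t)) ∈ openArc q r w' := mem_image_of_mem _ hs
      exact (ne_of_mem_openArc hqr hw' hz).1
        (hdisj ⟨h', (mem_moebiusArc_iff hqr hw').2 (Or.inr (Or.inr hz))⟩)
  -- By compactness of `[0, 1]`, the values stay in the open set `slitPlane` under small rotations.
  have key : ∀ᶠ φ : ℝ in 𝓝 0, ∀ t ∈ Icc (0 : ℝ) 1,
      adjacentRatio p q r w w' t * exp (-(φ * I)) ∈ slitPlane := by
    refine isCompact_Icc.eventually_forall_of_forall_eventually fun t ht => ?_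
    have hc : ContinuousAt (fun y : ℝ × ℝ =>
        adjacentRatio p q r w w' y.2 * exp (-(y.1 * I))) (0, t) := by
      have : w * (w' * (q - r)) ≠ 0 := by simp [hw0, hw0', sub_ne_zero.2 hqr]
      unfold adjacentRatio
      fun_prop (disch := assumption)
    exact hc.preimage_mem_nhds (isOpen_slitPlane.mem_nhds (by simpa using hmem t ht))
  filter_upwards [key, eventually_mul_exp_mem_slitPlane hw] with φ hφ hwφ z hz hz'
  have hzne := ne_of_mem_openArc hpq hwφ hz
  obtain ⟨s, hs, rfl⟩ := hz
  have hratio := arcRatio_arcPoint hpq hw0 hwφ (le_of_lt hs)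
  obtain ⟨t, ht0, ht1, ht⟩ : ∃ t : ℝ, 0 < t ∧ t ≤ 1 ∧
      (t : ℂ) * arcRatio p q w (arcPoint p q (w * exp (φ * I)) s) =
        adjacentRatio p q r w w' t := by
    rcases (mem_moebiusArc_iff hqr hw').1 hz' with h | h | ⟨s', hs', h⟩
    · exact absurd h hzne.2
    · refine ⟨1, one_pos, le_rfl, ?_⟩
      rw [h, ofReal_one, one_mul, arcRatio_target_adjacent hw0']
    · have hs' : 0 < s' := hs'
      refine ⟨s' / (1 + s'), by positivity, (div_le_one (by positivity)).2 (by linarith), ?_⟩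
      rw [← h, mul_arcRatio_arcPoint_adjacent hqr hw0 hw' hs']
  have h := hφ t ⟨ht0.le, ht1⟩
  rw [← ht, hratio] at h
  refine notMem_slitPlane_iff.2 ⟨t * s, mul_nonneg ht0.le (le_of_lt hs), ?_⟩ h
  have he : exp (φ * I) * exp (-(φ * I)) = 1 := by rw [← exp_add]; simp
  push_cast
  linear_combination (-(t : ℂ) * s) * he

/-! ### Triangles of arcs and a square root of the winding number -/

/-- Three arcs from `v 0` to `v 1` to `v 2` to `v 0` that meet only in the vertices. The arc from
`v i` to `v (i + 1)` has the parameter `w i`. At `v i` the counterclockwise angle from the outgoing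
to the incoming arc is `angle i`; the factor `exp (scale i)` is the length of the incoming tangent
vector `(w (i - 1))⁻¹ * (v (i - 1) - v i)` divided by that of the outgoing one,
`w i * (v (i + 1) - v i)`. -/
structure ArcTriangle where
  v : Fin 3 → ℂ
  w : Fin 3 → ℂ
  scale : Fin 3 → ℝ
  angle : Fin 3 → ℝ
  v_injective : Function.Injective v
  w_mem : ∀ i, w i ∈ slitPlane
  inter_subset : ∀ i, moebiusArc (v i) (v (i + 1)) (w i) ∩
    moebiusArc (v (i + 1)) (v (i + 1 + 1)) (w (i + 1)) ⊆ {v (i + 1)}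
  angle_mem : ∀ i, angle i ∈ Ioo 0 (2 * Real.pi)
  dir_eq : ∀ i, (w i)⁻¹ * (v i - v (i + 1)) =
    w (i + 1) * (v (i + 1 + 1) - v (i + 1)) * exp (scale (i + 1) + angle (i + 1) * I)

namespace ArcTriangle

variable (T : ArcTriangle)

/-- The arc from `v i` to `v (i + 1)`. -/
def edge (i : Fin 3) : Set ℂ := moebiusArc (T.v i) (T.v (i + 1)) (T.w i)

/-- The closed curve formed by the three arcs. -/
def curve : Set ℂ := ⋃ i, T.edge i

/-- The open arc from `v i` to `v (i + 1)` that makes the angle `φ` with `T.edge i`: for small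
`φ > 0` it runs along the left side of that edge, for small `φ < 0` along the right side. -/
def lens (i : Fin 3) (φ : ℝ) : Set ℂ := openArc (T.v i) (T.v (i + 1)) (T.w i * exp (φ * I))

/-- The function `arcRatio` of the arc from `v i` to `v (i + 1)`. -/
noncomputable def ratio (i : Fin 3) (z : ℂ) : ℂ := arcRatio (T.v i) (T.v (i + 1)) (T.w i) z

/-- A continuous square root of `∏ i, T.ratio i z` off the curve. That product does not depend on
`z`, and the sign of the root is the parity of the winding number, up to a constant. -/
noncomputable def windingSign (z : ℂ) : ℂ := exp ((∑ i, log (T.ratio i z)) / 2)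

/-- The limit of `windingSign` at infinity. -/
noncomputable def windingSignAtInfinity : ℂ := exp ((∑ i, log (T.w i)⁻¹) / 2)

theorem w_ne_zero (i : Fin 3) : T.w i ≠ 0 := slitPlane_ne_zero (T.w_mem i)

theorem v_ne (i : Fin 3) : T.v i ≠ T.v (i + 1) := fun h => by
  have h' := T.v_injective h
  clear h
  revert i
  decide

theorem isClosed_edge (i : Fin 3) : IsClosed (T.edge i) := isClosed_moebiusArc (T.w_ne_zero i)

theorem ratio_mem_slitPlane {z : ℂ} (hz : z ∉ T.curve) (i : Fin 3) : T.ratio i z ∈ slitPlane := by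
  by_contra h
  exact hz (mem_iUnion.2 ⟨i, h⟩)

theorem continuousAt_ratio {z : ℂ} {i : Fin 3} (hz : z ∉ T.edge i) :
    ContinuousAt (T.ratio i) z :=
  continuousAt_arcRatio_of_notMem (T.w_ne_zero i) hz

theorem continuousOn_windingSign : ContinuousOn T.windingSign T.curveᶜ := by
  intro z hz
  refine ContinuousAt.continuousWithinAt ?_
  have h : ∀ i, ContinuousAt (fun y => log (T.ratio i y)) z := fun i =>
    (T.continuousAt_ratio fun h => hz (mem_iUnion.2 ⟨i, h⟩)).clog (T.ratio_mem_slitPlane hz i)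
  have h2 : ContinuousAt (fun y => ∑ i, log (T.ratio i y)) z :=
    tendsto_finsetSum _ fun i _ => h i
  exact (h2.div_const 2).cexp

/-- The factors `z - v i` cancel around the triangle. -/
theorem windingSign_sq {z : ℂ} (hz : z ∉ T.curve) :
    T.windingSign z ^ 2 = (T.w 0 * T.w 1 * T.w 2)⁻¹ := by
  have h0 : ∀ i, T.ratio i z ≠ 0 := fun i => slitPlane_ne_zero (T.ratio_mem_slitPlane hz i)
  have h1 : ∀ i, z - T.v i ≠ 0 := fun i => sub_ne_zero.2 fun h => by
    subst h
    exact hz (mem_iUnion.2 ⟨i, source_mem_moebiusArc _ _ _⟩)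
  have hw := T.w_ne_zero
  rw [windingSign, ← exp_nat_mul]
  have h2 : ((2 : ℕ) : ℂ) * ((∑ i, log (T.ratio i z)) / 2) = ∑ i, log (T.ratio i z) := by
    push_cast; ring
  rw [h2, exp_sum, Fin.prod_univ_three, exp_log (h0 0), exp_log (h0 1), exp_log (h0 2)]
  have e : ∀ i, T.ratio i z = (z - T.v i) / ((z - T.v (i + 1)) * T.w i) := fun i => by
    rw [ratio, arcRatio, ← div_neg, ← neg_mul, neg_sub]
  rw [e, e, e]
  have e1 : (0 + 1 : Fin 3) = 1 := rfl
  have e2 : (1 + 1 : Fin 3) = 2 := rfl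
  have e3 : (2 + 1 : Fin 3) = 0 := rfl
  rw [e1, e2, e3]
  have := h1 0
  have := h1 1
  have := h1 2
  have := hw 0
  have := hw 1
  have := hw 2
  field_simp

theorem windingSign_eq_of_isPreconnected {S : Set ℂ} (hS : IsPreconnected S)
    (hSC : S ⊆ T.curveᶜ) {y z : ℂ} (hy : y ∈ S) (hz : z ∈ S) :
    T.windingSign y = T.windingSign z := by
  have hne : T.windingSign z ≠ 0 := exp_ne_zero _
  rcases hS.eq_or_eq_neg_of_sq_eq (T.continuousOn_windingSign.mono hSC)
    (continuousOn_const (c := T.windingSign z)) (fun x hx => by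
      simp [T.windingSign_sq (hSC hx), T.windingSign_sq (hSC hz)]) (fun _ => hne) with h | h
  · exact h hy
  · exact absurd (self_eq_neg.1 (h hz)) hne

theorem tendsto_ratio_cobounded (i : Fin 3) :
    Tendsto (T.ratio i) (Bornology.cobounded ℂ) (𝓝 (T.w i)⁻¹) := by
  have h1 : Tendsto (fun z : ℂ => z - T.v (i + 1)) (Bornology.cobounded ℂ)
      (Bornology.cobounded ℂ) := by
    exact tendsto_sub_const_cobounded _
  have h2 := (((tendsto_inv₀_cobounded.comp h1).const_mul (T.v (i + 1) - T.v i)).const_add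
    1).mul_const (T.w i)⁻¹
  simp only [mul_zero, add_zero, one_mul] at h2
  refine h2.congr' ?_
  filter_upwards [h1.eventually (Bornology.eventually_ne_cobounded 0)] with z hz
  rw [ratio, arcRatio, ← div_neg, ← neg_mul, neg_sub, Function.comp_apply]
  have := T.w_ne_zero i
  field_simp
  ring

theorem tendsto_windingSign_cobounded :
    Tendsto T.windingSign (Bornology.cobounded ℂ) (𝓝 T.windingSignAtInfinity) := by
  have h : Tendsto (fun y => ∑ i, log (T.ratio i y)) (Bornology.cobounded ℂ)
      (𝓝 (∑ i, log (T.w i)⁻¹)) :=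
    tendsto_finsetSum _ fun i _ =>
      (T.tendsto_ratio_cobounded i).clog (inv_mem_slitPlane_iff.2 (T.w_mem i))
  exact (h.div_const 2).cexp

theorem windingSign_eq_atInfinity {z : ℂ} (hz : z ∈ outsideCurve T.curve) :
    T.windingSign z = T.windingSignAtInfinity := by
  obtain ⟨hz, hunb⟩ := hz
  set K := connectedComponentIn T.curveᶜ z
  have hK : K ⊆ T.curveᶜ := connectedComponentIn_subset _ _
  have : (Bornology.cobounded ℂ ⊓ 𝓟 K).NeBot := by
    rw [neBot_iff, Ne, inf_principal_eq_bot]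
    exact hunb
  refine tendsto_nhds_unique (tendsto_const_nhds.congr' ?_)
    (T.tendsto_windingSign_cobounded.mono_left (inf_le_left (b := 𝓟 K)))
  filter_upwards [mem_inf_of_right (mem_principal_self K)] with y hy
  exact T.windingSign_eq_of_isPreconnected isPreconnected_connectedComponentIn hK
    (mem_connectedComponentIn hz) hy

theorem notMem_edge_succ {i : Fin 3} {z : ℂ} (hz : z ∈ T.edge i) (hz' : z ≠ T.v (i + 1)) :
    z ∉ T.edge (i + 1) := fun h => hz' (T.inter_subset i ⟨hz, h⟩)

theorem tendsto_neg_zero : Tendsto (fun φ : ℝ => -φ) (𝓝 0) (𝓝 0) := by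
  have : Tendsto (fun φ : ℝ => -φ) (𝓝 0) (𝓝 (-0)) := tendsto_id.neg
  rwa [neg_zero] at this

theorem log_neg_exp {φ : ℝ} (h0 : 0 < φ) (h1 : φ < Real.pi) :
    log (-exp (φ * I)) = (φ - Real.pi) * I ∧ log (-exp ((-φ : ℝ) * I)) = (Real.pi - φ) * I := by
  have e1 : -exp (φ * I) = exp ((φ - Real.pi : ℝ) * I) := by
    push_cast
    rw [sub_mul, exp_sub, exp_pi_mul_I, div_neg, div_one]
  have e2 : -exp ((-φ : ℝ) * I) = exp ((Real.pi - φ : ℝ) * I) := by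
    push_cast
    rw [sub_mul, exp_sub, exp_pi_mul_I, neg_mul, exp_neg, neg_div, one_div]
  rw [e1, e2, log_exp, log_exp]
  · simp
  all_goals simp; linarith

/-- The factor by which `windingSign` jumps: the square roots of `-e^{iφ}` and `-e^{-iφ}` tend to
`-i` and `i`. -/
theorem not_eventually_half_turn_eq {X : ℂ → ℂ} {m : ℝ → ℂ} (hm : ContinuousAt m 0)
    (hX : ContinuousAt X (m 0)) (hne : X (m 0) ≠ 0) :
    ¬ ∀ᶠ φ : ℝ in 𝓝[>] 0, exp ((φ - Real.pi) * I / 2) * X (m φ) =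
      exp ((Real.pi - φ) * I / 2) * X (m (-φ)) := by
  intro hev
  have hXm : Tendsto (fun φ => X (m φ)) (𝓝[>] 0) (𝓝 (X (m 0))) :=
    (ContinuousAt.comp hX hm).tendsto.mono_left nhdsWithin_le_nhds
  have hneg : Tendsto (fun φ : ℝ => -φ) (𝓝[>] 0) (𝓝 0) :=
    tendsto_neg_zero.mono_left nhdsWithin_le_nhds
  have hXm' : Tendsto (fun φ => X (m (-φ))) (𝓝[>] 0) (𝓝 (X (m 0))) :=
    (ContinuousAt.comp hX hm).tendsto.comp hneg
  have hE : ∀ (f : ℝ → ℂ), Continuous f →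
      Tendsto (fun φ => exp (f φ / 2)) (𝓝[>] 0) (𝓝 (exp (f 0 / 2))) := fun f hf =>
    (show Continuous fun φ => exp (f φ / 2) by fun_prop).continuousAt.tendsto.mono_left
      nhdsWithin_le_nhds
  have hL := (hE (fun φ => (φ - Real.pi) * I) (by fun_prop)).mul hXm
  have hR := (hE (fun φ => (Real.pi - φ) * I) (by fun_prop)).mul hXm'
  have h := mul_right_cancel₀ hne (tendsto_nhds_unique (hL.congr' hev) hR)
  have e1 : ((0 : ℝ) - Real.pi : ℂ) * I / 2 = -(Real.pi / 2 * I) := by push_cast; ring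
  have e2 : (Real.pi - (0 : ℝ) : ℂ) * I / 2 = Real.pi / 2 * I := by push_cast; ring
  rw [e1, e2, exp_neg, exp_pi_div_two_mul_I, inv_I, neg_eq_self] at h
  exact I_ne_zero h

theorem edge_zero : T.edge 0 = moebiusArc (T.v 0) (T.v 1) (T.w 0) := rfl

theorem windingSign_lens {φ : ℝ} (h : T.w 0 * exp (φ * I) ∈ slitPlane) :
    T.windingSign (arcPoint (T.v 0) (T.v 1) (T.w 0 * exp (φ * I)) 1) =
      exp (log (-exp (φ * I)) / 2) *
      exp ((log (T.ratio 1 (arcPoint (T.v 0) (T.v 1) (T.w 0 * exp (φ * I)) 1)) +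
        log (T.ratio 2 (arcPoint (T.v 0) (T.v 1) (T.w 0 * exp (φ * I)) 1))) / 2) := by
  have h1 : T.ratio 0 (arcPoint (T.v 0) (T.v 1) (T.w 0 * exp (φ * I)) 1) = -exp (φ * I) := by
    have := arcRatio_arcPoint (s := 1) (T.v_ne 0) (T.w_ne_zero 0) h zero_le_one
    rw [ofReal_one, one_mul] at this
    exact this
  rw [windingSign, Fin.sum_univ_three, ← exp_add, h1]
  congr 1
  ring

/-- `windingSign` takes different values on the two sides of the edge from `v 0` to `v 1`. -/
theorem not_eventually_windingSign_eq :
    ¬ ∀ᶠ φ : ℝ in 𝓝[>] 0,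
      T.windingSign (arcPoint (T.v 0) (T.v 1) (T.w 0 * exp (φ * I)) 1) =
      T.windingSign (arcPoint (T.v 0) (T.v 1) (T.w 0 * exp ((-φ : ℝ) * I)) 1) := by
  intro hev
  obtain ⟨z, hz⟩ : ∃ z, z = arcPoint (T.v 0) (T.v 1) (T.w 0 * exp ((0 : ℝ) * I)) 1 := ⟨_, rfl⟩
  have hv : T.v 0 ≠ T.v 1 := T.v_ne 0
  have hz0 : z ∈ openArc (T.v 0) (T.v 1) (T.w 0) := by
    rw [hz, ofReal_zero, zero_mul, exp_zero, mul_one]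
    exact mem_image_of_mem _ (mem_Ioi.2 one_pos)
  have hze : z ∈ T.edge 0 := by
    rw [edge_zero]
    exact (mem_moebiusArc_iff hv (T.w_mem 0)).2 (Or.inr (Or.inr hz0))
  have hzne := ne_of_mem_openArc hv (T.w_mem 0) hz0
  have hz1 : z ∉ T.edge 1 := by
    have := T.notMem_edge_succ (i := 0) hze
    rw [zero_add] at this
    exact this hzne.2
  have hz2 : z ∉ T.edge 2 := by
    intro h
    have := T.notMem_edge_succ h
    rw [show (2 + 1 : Fin 3) = 0 by decide] at this
    exact this hzne.1 hze
  have hXc : ContinuousAt (fun y => exp ((log (T.ratio 1 y) + log (T.ratio 2 y)) / 2)) z := by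
    have h1 : ContinuousAt (fun y => log (T.ratio 1 y)) z :=
      (T.continuousAt_ratio hz1).clog (not_not.1 hz1)
    have h2 : ContinuousAt (fun y => log (T.ratio 2 y)) z :=
      (T.continuousAt_ratio hz2).clog (not_not.1 hz2)
    exact ((h1.add h2).div_const 2).cexp
  have hmc : ContinuousAt
      (fun φ : ℝ => arcPoint (T.v 0) (T.v 1) (T.w 0 * exp (φ * I)) 1) 0 := by
    have : 1 + ((1 : ℝ) : ℂ) * (T.w 0 * exp ((0 : ℝ) * I)) ≠ 0 := by
      simpa using one_add_mul_ne_zero (T.w_mem 0) zero_le_one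
    unfold arcPoint
    fun_prop (disch := assumption)
  rw [hz] at hXc
  refine not_eventually_half_turn_eq hmc hXc (exp_ne_zero _) ?_
  have hpi : ∀ᶠ φ : ℝ in 𝓝[>] 0, φ < Real.pi :=
    nhdsWithin_le_nhds (gt_mem_nhds Real.pi_pos)
  have hslit := eventually_mul_exp_mem_slitPlane (T.w_mem 0)
  filter_upwards [hev, hpi, self_mem_nhdsWithin, nhdsWithin_le_nhds hslit,
    nhdsWithin_le_nhds (tendsto_neg_zero.eventually hslit)] with φ h1 h2 h3 h4 h5
  rw [T.windingSign_lens h4, T.windingSign_lens h5, (log_neg_exp h3 h2).1,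
    (log_neg_exp h3 h2).2] at h1
  exact h1

end ArcTriangle

/-! ### The two sides of a triangle of arcs -/

/-- Some connected set that avoids `C` contains both `A` and `B`. -/
def LinkedOff (C A B : Set ℂ) : Prop := ∃ S, IsPreconnected S ∧ S ⊆ Cᶜ ∧ A ⊆ S ∧ B ⊆ S

theorem LinkedOff.symm {C A B : Set ℂ} (h : LinkedOff C A B) : LinkedOff C B A := by
  obtain ⟨S, h1, h2, h3, h4⟩ := h
  exact ⟨S, h1, h2, h4, h3⟩

theorem LinkedOff.trans {C A B D : Set ℂ} (h : LinkedOff C A B) (h' : LinkedOff C B D)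
    (hB : B.Nonempty) : LinkedOff C A D := by
  obtain ⟨S, h1, h2, h3, h4⟩ := h
  obtain ⟨S', h1', h2', h3', h4'⟩ := h'
  obtain ⟨b, hb⟩ := hB
  exact ⟨S ∪ S', h1.union b (h4 hb) (h3' hb) h1', union_subset h2 h2',
    h3.trans subset_union_left, h4'.trans subset_union_right⟩

theorem openArc_nonempty (p q w : ℂ) : (openArc p q w).Nonempty :=
  ⟨_, mem_image_of_mem _ (mem_Ioi.2 one_pos)⟩

/-- An open arc off `C` lies in the component of its target, if that point is off `C` as well. -/
theorem openArc_subset_component {C : Set ℂ} {p q w : ℂ} (hw : w ∈ slitPlane)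
    (hA : openArc p q w ⊆ Cᶜ) (hq : q ∉ C) : openArc p q w ⊆ connectedComponentIn Cᶜ q := by
  have hpre : IsPreconnected (insert q (openArc p q w)) :=
    (isPreconnected_openArc hw).subset_closure (subset_insert _ _)
      (insert_subset (target_mem_closure_openArc hw) subset_closure)
  exact (subset_insert _ _).trans (hpre.subset_connectedComponentIn (mem_insert _ _)
    (insert_subset hq hA))

theorem LinkedOff.component_eq {C : Set ℂ} {p q w p' q' w' : ℂ}
    (h : LinkedOff C (openArc p q w) (openArc p' q' w'))
    (hw : w ∈ slitPlane) (hw' : w' ∈ slitPlane) (hq : q ∉ C) (hq' : q' ∉ C) :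
    connectedComponentIn Cᶜ q = connectedComponentIn Cᶜ q' := by
  obtain ⟨S, h1, h2, h3, h4⟩ := h
  obtain ⟨z, hz⟩ := openArc_nonempty p q w
  obtain ⟨z', hz'⟩ := openArc_nonempty p' q' w'
  have e1 := connectedComponentIn_eq (openArc_subset_component hw (h3.trans h2) hq hz)
  have e2 := connectedComponentIn_eq (openArc_subset_component hw' (h4.trans h2) hq' hz')
  have e3 := connectedComponentIn_eq (h1.subset_connectedComponentIn (h3 hz) h2 (h4 hz'))
  rw [e1, e2, e3]

namespace ArcTriangle

variable (T : ArcTriangle)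

theorem reverse_index_identities (i : Fin 3) :
    (1 - (i + 1) : Fin 3) = -i ∧ (1 - i : Fin 3) = -i + 1 ∧
    (-(i + 1) + 1 + 1 : Fin 3) = -i + 1 ∧ (1 - (i + 1 + 1) : Fin 3) = -(i + 1) ∧
    (-i : Fin 3) = -(i + 1) + 1 := by
  revert i
  decide

/-- The same curve, traversed in the opposite direction. The vertices are renumbered by
`i ↦ 1 - i`, which keeps the edge between `v 0` and `v 1` in its place. -/
noncomputable def reverse : ArcTriangle where
  v i := T.v (1 - i)
  w i := (T.w (-i))⁻¹
  scale i := -T.scale (1 - i)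
  angle i := 2 * Real.pi - T.angle (1 - i)
  v_injective i j h := by
    have := T.v_injective h
    exact sub_right_injective this
  w_mem i := inv_mem_slitPlane_iff.2 (T.w_mem _)
  inter_subset i := by
    obtain ⟨h1, h2, h3, h4, h5⟩ := reverse_index_identities i
    have := T.inter_subset (-(i + 1))
    rw [h3, ← h5] at this
    rw [h1, h2, h4, moebiusArc_reverse]
    have h6 := moebiusArc_reverse (T.v (-(i + 1))) (T.v (-i)) (T.w (-(i + 1)))
    rw [h6, inter_comm]
    exact this
  angle_mem i := ⟨by linarith [(T.angle_mem (1 - i)).2], by linarith [(T.angle_mem (1 - i)).1]⟩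
  dir_eq i := by
    obtain ⟨h1, h2, h3, h4, h5⟩ := reverse_index_identities i
    have := T.dir_eq (-(i + 1))
    rw [h3, ← h5] at this
    rw [h1, h2, h4, this, inv_inv, mul_assoc, ← exp_add]
    push_cast
    have e : (T.scale (-i) + T.angle (-i) * I +
      (-T.scale (-i) + (2 * Real.pi - T.angle (-i)) * I) : ℂ) = 2 * Real.pi * I := by ring
    rw [e, exp_two_pi_mul_I, mul_one]

theorem reverse_edge (i : Fin 3) : T.reverse.edge i = T.edge (-i) := by
  obtain ⟨h1, h2, -⟩ := reverse_index_identities i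
  change moebiusArc (T.v (1 - i)) (T.v (1 - (i + 1))) (T.w (-i))⁻¹ = _
  rw [h1, h2, moebiusArc_reverse]
  rfl

theorem reverse_curve : T.reverse.curve = T.curve := by
  unfold curve
  simp_rw [reverse_edge]
  exact (Equiv.neg (Fin 3)).surjective.iUnion_comp T.edge

theorem reverse_lens (i : Fin 3) {φ : ℝ} (h : T.w (-i) * exp ((-φ : ℝ) * I) ∈ slitPlane) :
    T.reverse.lens i φ = T.lens (-i) (-φ) := by
  obtain ⟨h1, h2, -⟩ := reverse_index_identities i
  change openArc (T.v (1 - i)) (T.v (1 - (i + 1))) ((T.w (-i))⁻¹ * exp (φ * I)) = _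
  rw [h1, h2]
  have : (T.w (-i))⁻¹ * exp (φ * I) = (T.w (-i) * exp ((-φ : ℝ) * I))⁻¹ := by
    rw [mul_inv, ← exp_neg]
    push_cast
    ring_nf
  rw [this, openArc_reverse h]
  rfl

theorem eventually_lens_disjoint_succ (i : Fin 3) :
    ∀ᶠ φ : ℝ in 𝓝 0, ∀ z ∈ T.lens i φ, z ∉ T.edge (i + 1) :=
  eventually_openArc_mul_exp_avoids_adjacent (T.v_ne i) (T.v_ne (i + 1)) (T.w_mem i)
    (T.w_mem (i + 1)) (T.inter_subset i) (T.dir_eq i) (T.angle_mem (i + 1))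

theorem eventually_lens_disjoint_pred (i : Fin 3) :
    ∀ᶠ φ : ℝ in 𝓝 0, ∀ z ∈ T.lens (i + 1) φ, z ∉ T.edge i := by
  have h := tendsto_neg_zero.eventually (T.reverse.eventually_lens_disjoint_succ (-(i + 1)))
  filter_upwards [h, eventually_mul_exp_mem_slitPlane (T.w_mem (i + 1))] with φ hφ hw
  rw [reverse_lens, reverse_edge, neg_neg, neg_neg] at hφ
  · have e : (-(-(i + 1) + 1) : Fin 3) = i := by
      clear h hφ hw
      revert i
      decide
    rwa [e] at hφ
  · rwa [neg_neg, neg_neg]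

theorem eventually_lens_disjoint_self (i : Fin 3) :
    ∀ᶠ φ : ℝ in 𝓝[≠] 0, ∀ z ∈ T.lens i φ, z ∉ T.edge i := by
  have hpi : 0 < 2 * Real.pi := Real.two_pi_pos
  filter_upwards [nhdsWithin_le_nhds (eventually_mul_exp_mem_slitPlane (T.w_mem i)),
    self_mem_nhdsWithin, nhdsWithin_le_nhds (Ioo_mem_nhds (neg_lt_zero.2 hpi) hpi)]
    with φ h1 h2 h3 z hz
  exact notMem_moebiusArc_of_mem_openArc_mul_exp (T.v_ne i) (T.w_mem i) h1 h2 h3.1 h3.2 hz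

theorem eventually_lens_subset :
    ∀ᶠ φ : ℝ in 𝓝[≠] 0, ∀ i, T.lens i φ ⊆ T.curveᶜ := by
  refine eventually_all.2 fun i => ?_
  filter_upwards [nhdsWithin_le_nhds (T.eventually_lens_disjoint_succ i),
    nhdsWithin_le_nhds (T.eventually_lens_disjoint_pred (i + 1 + 1)),
    T.eventually_lens_disjoint_self i] with φ h1 h2 h3 z hz hzC
  obtain ⟨j, hj⟩ := mem_iUnion.1 hzC
  have e : i + 1 + 1 + 1 = i ∧ (j = i ∨ j = i + 1 ∨ j = i + 1 + 1) := by
    clear h1 h2 h3 hz hzC hj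
    revert i j
    decide
  rw [e.1] at h2
  rcases e.2 with rfl | rfl | rfl
  · exact h3 z hz hj
  · exact h1 z hz hj
  · exact h2 z hz hj

/-- The tangent vector `w i * (v (i + 1) - v i)` of the outgoing arc at `v i`. -/
noncomputable def dir (i : Fin 3) : ℂ := T.w i * (T.v (i + 1) - T.v i)

theorem v_notMem_opposite_edge (i : Fin 3) : T.v (i + 1) ∉ T.edge (i + 1 + 1) := by
  intro h
  have h1 := T.inter_subset (i + 1) ⟨source_mem_moebiusArc _ _ _, h⟩
  exact T.v_ne (i + 1) h1

/-- Near a vertex the curve avoids the sector to its left: two of the edges bound that sector, and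
the third one stays away from the vertex. -/
theorem sectorAvoids (i : Fin 3) :
    SectorAvoids T.curve (T.v (i + 1)) (T.dir (i + 1)) (T.angle (i + 1)) := by
  intro θ₁ θ₂ h₁ h₂
  have hθ := T.angle_mem (i + 1)
  have hout := eventually_ray_notMem_moebiusArc (x := 0) (θ := 0) (θ₁ := θ₁) (θ₂ := θ₂)
    (a := T.dir (i + 1)) (T.v_ne (i + 1)) (T.w_mem (i + 1)) (by simp [dir])
    (fun ψ hψ => ⟨by linarith [hψ.1], by linarith [hψ.1, Real.pi_pos], by linarith [hψ.2, hθ.2]⟩)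
  have hback := eventually_ray_notMem_moebiusArc (x := T.scale (i + 1))
    (θ := T.angle (i + 1)) (θ₁ := θ₁) (θ₂ := θ₂)
    (a := T.dir (i + 1)) (T.v_ne i).symm (inv_mem_slitPlane_iff.2 (T.w_mem i)) (T.dir_eq i)
    (fun ψ hψ => ⟨by linarith [hψ.2], by linarith [hψ.1, hθ.2],
      by linarith [hψ.2, hθ.1, Real.pi_pos]⟩)
  have hopp := eventually_ray_notMem_of_isClosed (a := T.dir (i + 1)) (T.isClosed_edge (i + 1 + 1))
    (T.v_notMem_opposite_edge i) θ₁ θ₂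
  filter_upwards [hout, hback, hopp] with r h1 h2 h3 ψ hψ hC
  obtain ⟨j, hj⟩ := mem_iUnion.1 hC
  have e : j = i ∨ j = i + 1 ∨ j = i + 1 + 1 := by
    clear * -
    revert i j
    decide
  rcases e with rfl | rfl | rfl
  · refine h2 ψ hψ ?_
    rw [moebiusArc_reverse]
    exact hj
  · exact h1 ψ hψ hj
  · exact h3 ψ hψ hj

/-- The arc from `v i` to `q` with parameter `w` leaves `v i` to the left of the curve, strictly
between the outgoing and the incoming arc in the counterclockwise sense. -/
def LeavesLeft (i : Fin 3) (q w : ℂ) : Prop :=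
  ∃ x ψ : ℝ, ψ ∈ Ioo 0 (T.angle i) ∧ w * (q - T.v i) = T.dir i * exp (x + ψ * I)

/-- The arc from `v i` to `q` with parameter `w` leaves `v i` to the right of the curve, strictly
between the incoming and the outgoing arc in the counterclockwise sense. -/
def LeavesRight (i : Fin 3) (q w : ℂ) : Prop :=
  ∃ x ψ : ℝ, ψ ∈ Ioo (T.angle i) (2 * Real.pi) ∧ w * (q - T.v i) = T.dir i * exp (x + ψ * I)

theorem LeavesLeft.linkedOff {i : Fin 3} {q w q' w' : ℂ} (h : T.LeavesLeft i q w)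
    (h' : T.LeavesLeft i q' w') (hw : w ∈ slitPlane) (hw' : w' ∈ slitPlane)
    (hA : openArc (T.v i) q w ⊆ T.curveᶜ) (hA' : openArc (T.v i) q' w' ⊆ T.curveᶜ) :
    LinkedOff T.curve (openArc (T.v i) q w) (openArc (T.v i) q' w') := by
  obtain ⟨j, rfl⟩ : ∃ j, i = j + 1 := ⟨i - 1, by simp⟩
  obtain ⟨x, ψ, hψ, hd⟩ := h
  obtain ⟨x', ψ', hψ', hd'⟩ := h'
  exact exists_isPreconnected_of_sectorAvoids (T.sectorAvoids j) hw hw' hd hd' hψ hψ' hA hA'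

theorem leavesLeft_lens {i : Fin 3} {φ : ℝ} (hφ : φ ∈ Ioo 0 (T.angle i)) :
    T.LeavesLeft i (T.v (i + 1)) (T.w i * exp (φ * I)) :=
  ⟨0, φ, hφ, by rw [dir]; push_cast; rw [zero_add]; ring⟩

theorem leavesLeft_lens_pred {i : Fin 3} {φ : ℝ} (hφ : φ ∈ Ioo 0 (T.angle (i + 1))) :
    T.LeavesLeft (i + 1) (T.v i) (T.w i * exp (φ * I))⁻¹ := by
  refine ⟨T.scale (i + 1), T.angle (i + 1) - φ, ⟨by linarith [hφ.2], by linarith [hφ.1]⟩, ?_⟩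
  have h := T.dir_eq i
  have e : (T.scale (i + 1) + (T.angle (i + 1) - φ : ℝ) * I : ℂ) =
      T.scale (i + 1) + T.angle (i + 1) * I + -(φ * I) := by push_cast; ring
  rw [e, exp_add, mul_inv, ← exp_neg, dir, ← mul_assoc (_ * _), ← h]
  ring

theorem eventually_angle : ∀ᶠ φ : ℝ in 𝓝[>] 0, ∀ i, φ ∈ Ioo 0 (T.angle i) :=
  eventually_all.2 fun i => Ioo_mem_nhdsGT (T.angle_mem i).1

theorem eventually_lens_mem_slitPlane :
    ∀ᶠ φ : ℝ in 𝓝[>] 0, ∀ i, T.w i * exp (φ * I) ∈ slitPlane :=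
  eventually_all.2 fun i => nhdsWithin_le_nhds (eventually_mul_exp_mem_slitPlane (T.w_mem i))

/-- The left side of the curve is connected: every arc that leaves to the left, at whichever vertex,
is linked to the left side of the edge from `v 0` to `v 1`. Consecutive edges are linked through the
sector at their common vertex. -/
theorem LeavesLeft.eventually_linkedOff_lens {i : Fin 3} {q w : ℂ} (h : T.LeavesLeft i q w)
    (hw : w ∈ slitPlane) (hA : openArc (T.v i) q w ⊆ T.curveᶜ) :
    ∀ᶠ φ : ℝ in 𝓝[>] 0, LinkedOff T.curve (openArc (T.v i) q w) (T.lens 0 φ) := by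
  have hsub : ∀ᶠ φ : ℝ in 𝓝[>] 0, ∀ i, T.lens i φ ⊆ T.curveᶜ :=
    nhdsWithin_mono _ (fun φ (hφ : 0 < φ) => hφ.ne') T.eventually_lens_subset
  filter_upwards [hsub, T.eventually_angle, T.eventually_lens_mem_slitPlane] with φ h1 h2 h3
  have hstep : ∀ j, LinkedOff T.curve (T.lens j φ) (T.lens (j + 1) φ) := by
    intro j
    have hrev : openArc (T.v (j + 1)) (T.v j) (T.w j * exp (φ * I))⁻¹ = T.lens j φ :=
      openArc_reverse (h3 j)
    have := (T.leavesLeft_lens_pred (h2 (j + 1))).linkedOff T (T.leavesLeft_lens (h2 (j + 1)))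
      (inv_mem_slitPlane_iff.2 (h3 j)) (h3 (j + 1)) (hrev ▸ h1 j) (h1 (j + 1))
    rwa [hrev] at this
  have hi : LinkedOff T.curve (openArc (T.v i) q w) (T.lens i φ) :=
    h.linkedOff T (T.leavesLeft_lens (h2 i)) hw (h3 i) hA (h1 i)
  have hne : ∀ j, (T.lens j φ).Nonempty := fun j => openArc_nonempty _ _ _
  have e : i = 0 ∨ i + 1 = 0 ∨ 0 + 1 = i := by
    clear * -
    revert i
    decide
  rcases e with e | e | e
  · subst e
    exact hi
  · have := hstep i
    rw [e] at this
    exact hi.trans this (hne i)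
  · have := (hstep 0).symm
    rw [e] at this
    exact hi.trans this (hne i)

theorem LeavesRight.leavesLeft_reverse {i : Fin 3} {q w : ℂ} (h : T.LeavesRight i q w) :
    T.reverse.LeavesLeft (1 - i) q w := by
  obtain ⟨j, rfl⟩ : ∃ j, i = j + 1 := ⟨i - 1, by simp⟩
  obtain ⟨x, ψ, hψ, hd⟩ := h
  have e : (1 - (1 - (j + 1)) : Fin 3) = j + 1 ∧ (-(1 - (j + 1)) : Fin 3) = j ∧
      (1 - (1 - (j + 1) + 1) : Fin 3) = j := by
    clear * -
    revert j
    decide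
  refine ⟨x - T.scale (j + 1), ψ - T.angle (j + 1), ⟨by linarith [hψ.1], ?_⟩, ?_⟩
  · change _ < 2 * Real.pi - T.angle (1 - (1 - (j + 1)))
    rw [e.1]
    linarith [hψ.2]
  · change w * (q - T.v (1 - (1 - (j + 1)))) = (T.w (-(1 - (j + 1))))⁻¹ *
      (T.v (1 - (1 - (j + 1) + 1)) - T.v (1 - (1 - (j + 1)))) * _
    rw [e.1, e.2.1, e.2.2, hd, T.dir_eq, mul_assoc, ← exp_add, dir]
    congr 2
    push_cast
    ring

/-- The right side of the curve is the left side of the reversed curve. -/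
theorem LeavesRight.eventually_linkedOff_lens {i : Fin 3} {q w : ℂ} (h : T.LeavesRight i q w)
    (hw : w ∈ slitPlane) (hA : openArc (T.v i) q w ⊆ T.curveᶜ) :
    ∀ᶠ φ : ℝ in 𝓝[>] 0, LinkedOff T.curve (openArc (T.v i) q w) (T.lens 0 (-φ)) := by
  have e : T.reverse.v (1 - i) = T.v i := by
    change T.v (1 - (1 - i)) = _
    rw [sub_sub_cancel]
  have h1 := (h.leavesLeft_reverse T).eventually_linkedOff_lens T.reverse hw
    (by rwa [e, reverse_curve])
  rw [e, reverse_curve] at h1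
  have hneg : Tendsto (fun φ : ℝ => -φ) (𝓝[>] 0) (𝓝 0) :=
    tendsto_neg_zero.mono_left nhdsWithin_le_nhds
  filter_upwards [h1, hneg.eventually (eventually_mul_exp_mem_slitPlane (T.w_mem 0))] with φ h2 h3
  rw [T.reverse_lens 0 (by rwa [neg_zero]), neg_zero] at h2
  exact h2

theorem mem_lens_zero (φ : ℝ) :
    arcPoint (T.v 0) (T.v 1) (T.w 0 * exp (φ * I)) 1 ∈ T.lens 0 φ :=
  mem_image_of_mem _ (mem_Ioi.2 one_pos)

/-- The arc from `v i` to `q` with parameter `w` meets the curve only in `v i`. -/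
structure IsPendant (i : Fin 3) (q w : ℂ) : Prop where
  w_mem : w ∈ slitPlane
  notMem : q ∉ T.curve
  subset : openArc (T.v i) q w ⊆ T.curveᶜ

variable {T}

theorem IsPendant.component_eq_of_left {i j : Fin 3} {q w q' w' : ℂ} (hp : T.IsPendant i q w)
    (hp' : T.IsPendant j q' w') (h : T.LeavesLeft i q w) (h' : T.LeavesLeft j q' w') :
    connectedComponentIn T.curveᶜ q = connectedComponentIn T.curveᶜ q' := by
  obtain ⟨φ, h1, h2⟩ := ((h.eventually_linkedOff_lens T hp.w_mem hp.subset).and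
    (h'.eventually_linkedOff_lens T hp'.w_mem hp'.subset)).exists
  exact LinkedOff.component_eq (h1.trans h2.symm (openArc_nonempty _ _ _))
    hp.w_mem hp'.w_mem hp.notMem hp'.notMem

theorem IsPendant.component_eq_of_right {i j : Fin 3} {q w q' w' : ℂ} (hp : T.IsPendant i q w)
    (hp' : T.IsPendant j q' w') (h : T.LeavesRight i q w) (h' : T.LeavesRight j q' w') :
    connectedComponentIn T.curveᶜ q = connectedComponentIn T.curveᶜ q' := by
  obtain ⟨φ, h1, h2⟩ := ((h.eventually_linkedOff_lens T hp.w_mem hp.subset).and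
    (h'.eventually_linkedOff_lens T hp'.w_mem hp'.subset)).exists
  exact LinkedOff.component_eq (h1.trans h2.symm (openArc_nonempty _ _ _))
    hp.w_mem hp'.w_mem hp.notMem hp'.notMem

theorem IsPendant.windingSign_eq {i : Fin 3} {q w : ℂ} {B : Set ℂ} (hp : T.IsPendant i q w)
    (h : LinkedOff T.curve (openArc (T.v i) q w) B) {z : ℂ} (hz : z ∈ B) :
    T.windingSign z = T.windingSign q := by
  obtain ⟨S, h1, h2, h3, h4⟩ := h
  obtain ⟨y, hy⟩ := openArc_nonempty (T.v i) q w
  rw [T.windingSign_eq_of_isPreconnected h1 h2 (h4 hz) (h3 hy)]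
  exact T.windingSign_eq_of_isPreconnected isPreconnected_connectedComponentIn
    (connectedComponentIn_subset _ _)
    (openArc_subset_component hp.w_mem hp.subset hp.notMem hy)
    (mem_connectedComponentIn hp.notMem)

theorem IsPendant.not_outside_both_sides {i j : Fin 3} {q w q' w' : ℂ}
    (hp : T.IsPendant i q w) (hp' : T.IsPendant j q' w') (h : T.LeavesLeft i q w)
    (h' : T.LeavesRight j q' w') (hq : q ∈ outsideCurve T.curve)
    (hq' : q' ∈ outsideCurve T.curve) : False := by
  refine T.not_eventually_windingSign_eq ?_
  filter_upwards [h.eventually_linkedOff_lens T hp.w_mem hp.subset,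
    h'.eventually_linkedOff_lens T hp'.w_mem hp'.subset] with φ h1 h2
  rw [hp.windingSign_eq h1 (T.mem_lens_zero φ), hp'.windingSign_eq h2 (T.mem_lens_zero (-φ)),
    T.windingSign_eq_atInfinity hq, T.windingSign_eq_atInfinity hq']

end ArcTriangle

/-! ### Line segments and circular arcs have a Möbius parameter -/

theorem exp_sub_exp_mul_I (x y : ℝ) : exp (y * I) - exp (x * I) =
    2 * I * Real.sin ((y - x) / 2) * exp (((x + y) / 2 : ℝ) * I) := by
  have e1 : exp (y * I) = exp (((x + y) / 2 : ℝ) * I) * exp (((y - x) / 2 : ℝ) * I) := by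
    rw [← exp_add]; push_cast; ring_nf
  have e2 : exp (x * I) = exp (((x + y) / 2 : ℝ) * I) * exp (-((y - x) / 2 : ℝ) * I) := by
    rw [← exp_add]; push_cast; ring_nf
  rw [e1, e2, ofReal_sin, Complex.sin]
  linear_combination (-1) * exp (((x + y) / 2 : ℝ) * I) *
    (exp (-((y - x) / 2 : ℝ) * I) - exp (((y - x) / 2 : ℝ) * I)) * I_sq

theorem segment_eq_moebiusArc {p q : ℂ} (hpq : p ≠ q) : segment ℝ p q = moebiusArc p q 1 := by
  ext z
  rw [mem_moebiusArc_iff hpq one_mem_slitPlane]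
  constructor
  · rintro ⟨a, b, ha, hb, hab, rfl⟩
    rcases ha.eq_or_lt with rfl | ha
    · right; left
      rw [zero_add] at hab
      simp [hab]
    rcases hb.eq_or_lt with rfl | hb
    · left
      rw [add_zero] at hab
      simp [hab]
    · right; right
      refine ⟨b / a, div_pos hb ha,
        (eq_arcPoint_of_sub_eq one_mem_slitPlane (by positivity) ?_).symm⟩
      have h1 : (a : ℂ) ≠ 0 := by exact_mod_cast ha.ne'
      have h2 : (a : ℂ) + b = 1 := by exact_mod_cast hab
      have h3 : (b : ℂ) = 1 - a := by linear_combination h2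
      simp only [real_smul]
      push_cast
      rw [h3]
      field_simp
      ring
  · rintro (rfl | rfl | ⟨s, hs, rfl⟩)
    · exact left_mem_segment ..
    · exact right_mem_segment ..
    · have hs : 0 < s := hs
      have h1 : (1 + s : ℂ) ≠ 0 := by exact_mod_cast (by positivity : (1 + s : ℝ) ≠ 0)
      refine ⟨1 / (1 + s), s / (1 + s), by positivity, by positivity, by field_simp, ?_⟩
      rw [arcPoint]
      simp only [real_smul]
      push_cast
      field_simp

/-- The parameter of the arc of a circle between the polar angles `a` and `b` is
`e^{-i(b - a)/2}`: at the polar angle `t` the ratio `(z - p) / ((q - z) w)` is the real number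
`sin ((t - a) / 2) / sin ((b - t) / 2)`. -/
theorem circular_chord_identity (c : ℂ) (r a b t : ℝ) :
    (Real.sin ((b - t) / 2) : ℂ) * (c + r * exp (t * I) - (c + r * exp (a * I))) =
      Real.sin ((t - a) / 2) * exp ((-((b - a) / 2) : ℝ) * I) *
        (c + r * exp (b * I) - (c + r * exp (t * I))) := by
  have h1 := exp_sub_exp_mul_I a t
  have h2 := exp_sub_exp_mul_I t b
  have h3 : exp (((a + t) / 2 : ℝ) * I) =
      exp ((-((b - a) / 2) : ℝ) * I) * exp (((t + b) / 2 : ℝ) * I) := by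
    rw [← exp_add]; push_cast; ring_nf
  rw [h3] at h1
  linear_combination (Real.sin ((b - t) / 2) : ℂ) * r * h1 -
    Real.sin ((t - a) / 2) * exp ((-((b - a) / 2) : ℝ) * I) * r * h2

theorem exp_neg_mul_I_mem_slitPlane {x : ℝ} (h0 : 0 < x) (h1 : x < Real.pi) :
    exp ((-x : ℝ) * I) ∈ slitPlane := by
  rw [mem_slitPlane_iff]
  right
  rw [exp_ofReal_mul_I_im, Real.sin_neg, neg_ne_zero]
  exact (Real.sin_pos_of_pos_of_lt_pi h0 h1).ne'

theorem circular_carrier_eq_moebiusArc (c : ℂ) {r a b : ℝ} (hab : a < b)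
    (hb : b < a + 2 * Real.pi) (hne : c + r * exp (a * I) ≠ c + r * exp (b * I)) :
    (fun t : ℝ => c + (r : ℂ) * exp ((t : ℂ) * I)) '' Icc a b =
      moebiusArc (c + r * exp (a * I)) (c + r * exp (b * I)) (exp ((-((b - a) / 2) : ℝ) * I)) := by
  have hw := exp_neg_mul_I_mem_slitPlane (x := (b - a) / 2) (by linarith) (by linarith)
  ext z
  rw [mem_moebiusArc_iff hne hw]
  constructor
  · rintro ⟨t, ht, rfl⟩
    rcases ht.1.eq_or_lt with rfl | ht1
    · exact Or.inl rfl
    rcases ht.2.eq_or_lt with rfl | ht2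
    · exact Or.inr (Or.inl rfl)
    right; right
    have h1 : 0 < Real.sin ((t - a) / 2) :=
      Real.sin_pos_of_pos_of_lt_pi (by linarith) (by linarith)
    have h2 : 0 < Real.sin ((b - t) / 2) :=
      Real.sin_pos_of_pos_of_lt_pi (by linarith) (by linarith)
    refine ⟨_, mem_Ioi.2 (div_pos h1 h2), (eq_arcPoint_of_sub_eq hw (div_pos h1 h2).le ?_).symm⟩
    have h := circular_chord_identity c r a b t
    have h3 : (Real.sin ((b - t) / 2) : ℂ) ≠ 0 := by exact_mod_cast h2.ne'
    rw [ofReal_div, div_mul_eq_mul_div, div_mul_eq_mul_div, eq_div_iff h3]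
    linear_combination h
  · rintro (rfl | rfl | ⟨s, hs, rfl⟩)
    · exact ⟨a, left_mem_Icc.2 hab.le, rfl⟩
    · exact ⟨b, right_mem_Icc.2 hab.le, rfl⟩
    · have hs : 0 < s := hs
      have h0 : 0 < Real.sin ((b - a) / 2) :=
        Real.sin_pos_of_pos_of_lt_pi (by linarith) (by linarith)
      -- The polar angle of the point with parameter `s` comes from the intermediate value theorem.
      obtain ⟨t, ht, h⟩ : (0 : ℝ) ∈
          (fun t => Real.sin ((t - a) / 2) - s * Real.sin ((b - t) / 2)) '' Icc a b := by
        refine intermediate_value_Icc hab.le (by fun_prop) ⟨?_, ?_⟩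
        · simp only [sub_self, zero_div, Real.sin_zero, zero_sub]
          nlinarith
        · simp only [sub_self, zero_div, Real.sin_zero, mul_zero, sub_zero]
          exact h0.le
      simp only at h
      have htb : t < b := by
        refine lt_of_le_of_ne ht.2 ?_
        rintro rfl
        simp only [sub_self, zero_div, Real.sin_zero, mul_zero, sub_zero] at h
        exact h0.ne' h
      have h2 : 0 < Real.sin ((b - t) / 2) :=
        Real.sin_pos_of_pos_of_lt_pi (by linarith) (by linarith [ht.1])
      refine ⟨t, ht, eq_arcPoint_of_sub_eq hw hs.le ?_⟩
      have h3 : (Real.sin ((b - t) / 2) : ℂ) ≠ 0 := by exact_mod_cast h2.ne'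
      have h4 := circular_chord_identity c r a b t
      have h5 : (Real.sin ((t - a) / 2) : ℂ) = s * Real.sin ((b - t) / 2) := by
        exact_mod_cast sub_eq_zero.1 h
      rw [h5] at h4
      refine mul_left_cancel₀ h3 ?_
      linear_combination h4

/-- Every segment and every circular arc has a Möbius parameter, and its unit tangent vectors at the
endpoints are positive multiples of `w (q - p)` and `w⁻¹ (p - q)`. -/
theorem CircularArc.exists_moebiusArc (A : CircularArc) (hne : A.source ≠ A.target) :
    ∃ w ∈ slitPlane, A.carrier = moebiusArc A.source A.target w ∧
      (∃ r : ℝ, 0 < r ∧ A.sourceDir = r * (w * (A.target - A.source))) ∧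
      ∃ r : ℝ, 0 < r ∧ A.targetDir = r * (w⁻¹ * (A.source - A.target)) := by
  cases A with
  | lineSegment p q hpq =>
    refine ⟨1, one_mem_slitPlane, segment_eq_moebiusArc hpq, ⟨‖q - p‖⁻¹, ?_, ?_⟩,
      ⟨‖p - q‖⁻¹, ?_, ?_⟩⟩
    · exact inv_pos.2 (norm_pos_iff.2 (sub_ne_zero.2 hpq.symm))
    · simp only [sourceDir, source, target]
      push_cast
      ring
    · exact inv_pos.2 (norm_pos_iff.2 (sub_ne_zero.2 hpq))
    · simp only [targetDir, source, target]
      push_cast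
      ring
  | circular c r a b hr hab hb =>
    have h0 : 0 < Real.sin ((b - a) / 2) :=
      Real.sin_pos_of_pos_of_lt_pi (by linarith) (by linarith)
    have h1 : (Real.sin ((b - a) / 2) : ℂ) ≠ 0 := by exact_mod_cast h0.ne'
    have h2 : (r : ℂ) ≠ 0 := by exact_mod_cast hr.ne'
    have h3 := exp_sub_exp_mul_I a b
    refine ⟨exp ((-((b - a) / 2) : ℝ) * I),
      exp_neg_mul_I_mem_slitPlane (by linarith) (by linarith),
      circular_carrier_eq_moebiusArc c hab hb hne,
      ⟨(2 * r * Real.sin ((b - a) / 2))⁻¹, by positivity, ?_⟩,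
      ⟨(2 * r * Real.sin ((b - a) / 2))⁻¹, by positivity, ?_⟩⟩
    · have h4 : exp (a * I) = exp ((-((b - a) / 2) : ℝ) * I) * exp (((a + b) / 2 : ℝ) * I) := by
        rw [← exp_add]; push_cast; ring_nf
      simp only [sourceDir, source, target]
      rw [add_sub_add_left_eq_sub, ← mul_sub, h3, h4]
      push_cast at h1 ⊢
      field_simp
    · have h4 : exp (b * I) =
          (exp ((-((b - a) / 2) : ℝ) * I))⁻¹ * exp (((a + b) / 2 : ℝ) * I) := by
        rw [← exp_neg, ← exp_add]; push_cast; ring_nf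
      simp only [targetDir, source, target]
      rw [add_sub_add_left_eq_sub, ← mul_sub, ← neg_sub (exp (b * I)), h3, h4]
      push_cast at h1 ⊢
      field_simp

theorem CircularArc.exists_moebiusArc_of_ends (A : CircularArc) {x y : ℂ} (hxy : x ≠ y)
    (h : s(A.source, A.target) = s(x, y)) :
    ∃ w ∈ slitPlane, A.carrier = moebiusArc x y w ∧
      (∀ u, A.LeavesInDirection x u → ∃ r : ℝ, 0 < r ∧ u = r * (w * (y - x))) ∧
      ∀ u, A.LeavesInDirection y u → ∃ r : ℝ, 0 < r ∧ u = r * (w⁻¹ * (x - y)) := by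
  rcases Sym2.eq_iff.1 h with ⟨rfl, rfl⟩ | ⟨rfl, rfl⟩
  · obtain ⟨w, hw, hc, hs, ht⟩ := A.exists_moebiusArc hxy
    refine ⟨w, hw, hc, ?_, ?_⟩
    · rintro u (⟨-, rfl⟩ | ⟨h', -⟩)
      · exact hs
      · exact absurd h' hxy
    · rintro u (⟨h', -⟩ | ⟨-, rfl⟩)
      · exact absurd h'.symm hxy
      · exact ht
  · obtain ⟨w, hw, hc, hs, ht⟩ := A.exists_moebiusArc hxy.symm
    refine ⟨w⁻¹, inv_mem_slitPlane_iff.2 hw, by rw [moebiusArc_reverse, hc], ?_, ?_⟩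
    · rintro u (⟨h', -⟩ | ⟨-, rfl⟩)
      · exact absurd h' hxy
      · exact ht
    · rw [inv_inv]
      rintro u (⟨-, rfl⟩ | ⟨h', -⟩)
      · exact hs
      · exact absurd h'.symm hxy

/-! ### Triangles with angles of 60, 60 and 300 degrees -/

/-- The algebraic obstruction. The hypotheses `h₀`, `h₁`, `h₂` say that the angles from the outgoing
to the incoming arc at `v₀`, `v₁`, `v₂` are those of `ζ`, `ζ`, `ζ⁻¹`, where `ζ` is a primitive sixth
root of unity. -/
theorem exists_crossing {v₀ v₁ v₂ w₀ w₁ w₂ ζ : ℂ} {r₀ r₁ r₂ : ℝ} (h01 : v₀ ≠ v₁) (h12 : v₁ ≠ v₂)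
    (h20 : v₂ ≠ v₀) (hw₀ : w₀ ∈ slitPlane) (hw₁ : w₁ ∈ slitPlane) (hw₂ : w₂ ∈ slitPlane)
    (hr₀ : 0 < r₀) (hr₁ : 0 < r₁) (hr₂ : 0 < r₂) (hζ : ζ ^ 2 - ζ + 1 = 0)
    (h₀ : w₂⁻¹ * (v₂ - v₀) = w₀ * (v₁ - v₀) * (r₀ * ζ))
    (h₁ : w₀⁻¹ * (v₀ - v₁) = w₁ * (v₂ - v₁) * (r₁ * ζ))
    (h₂ : w₁⁻¹ * (v₁ - v₂) = w₂ * (v₀ - v₂) * (r₂ * ζ⁻¹)) :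
    v₂ ∈ moebiusArc v₀ v₁ w₀ ∨ ∃ z ∈ openArc v₁ v₂ w₁, z ∈ openArc v₂ v₀ w₂ := by
  have hw₀0 := slitPlane_ne_zero hw₀
  have hw₁0 := slitPlane_ne_zero hw₁
  have hw₂0 := slitPlane_ne_zero hw₂
  have hζ0 : ζ ≠ 0 := by
    rintro rfl
    simp at hζ
  have hζ3 : ζ ^ 3 = -1 := by linear_combination (ζ + 1) * hζ
  have d01 := sub_ne_zero.2 h01
  have d12 := sub_ne_zero.2 h12
  have d20 := sub_ne_zero.2 h20
  rw [inv_mul_eq_iff_eq_mul₀ hw₂0] at h₀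
  rw [inv_mul_eq_iff_eq_mul₀ hw₀0] at h₁
  rw [inv_mul_eq_iff_eq_mul₀ hw₁0] at h₂
  have h₂' : ζ * (v₁ - v₂) = r₂ * w₁ * w₂ * (v₀ - v₂) := by
    rw [h₂]
    field_simp
  obtain ⟨k, hk, hk2⟩ : ∃ k : ℝ, 0 < k ∧ k ^ 2 * (r₀ * r₁) = r₂ :=
    ⟨Real.sqrt (r₂ / (r₀ * r₁)), Real.sqrt_pos.2 (by positivity), by
      rw [Real.sq_sqrt (by positivity)]
      field_simp⟩
  have hk2' : (k : ℂ) ^ 2 * (r₀ * r₁) = r₂ := by exact_mod_cast hk2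
  have hr₀' : (r₀ : ℂ) ≠ 0 := by exact_mod_cast hr₀.ne'
  have hr₁' : (r₁ : ℂ) ≠ 0 := by exact_mod_cast hr₁.ne'
  have hk' : (k : ℂ) ≠ 0 := by exact_mod_cast hk.ne'
  -- The product of the first two conditions, divided by the third.
  have hsq : (w₀ * (v₁ - v₂)) ^ 2 = (k * (v₂ - v₀)) ^ 2 := by
    have e : (v₂ - v₀) * (v₀ - v₁) * (r₂ * w₁ * w₂ * (v₀ - v₂)) =
        (w₂ * (w₀ * (v₁ - v₀) * (r₀ * ζ))) * (w₀ * (w₁ * (v₂ - v₁) * (r₁ * ζ))) *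
          (ζ * (v₁ - v₂)) := by
      rw [← h₀, ← h₁, ← h₂']
    have hne : (r₀ : ℂ) * r₁ * (w₁ * w₂ * (v₀ - v₁)) ≠ 0 := by
      simp [hr₀', hr₁', hw₁0, hw₂0, d01]
    refine mul_left_cancel₀ hne ?_
    rw [← hk2'] at e
    linear_combination e + r₀ * r₁ * w₁ * w₂ * (v₀ - v₁) * w₀ ^ 2 * (v₁ - v₂) ^ 2 * hζ3
  -- The sign `+` puts `v₂` on the first arc; the sign `-` makes the other two arcs cross.
  rcases sq_eq_sq_iff_eq_or_eq_neg.1 hsq with h | h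
  · left
    refine notMem_slitPlane_iff.2 ⟨k⁻¹, (inv_pos.2 hk).le, ?_⟩
    rw [arcRatio, mul_comm _ w₀, h, div_mul_cancel_right₀ d20, ofReal_inv]
  · right
    have e1 : ((r₁ * k : ℝ) : ℂ) * w₁ * (v₂ - v₀) * ζ = v₀ - v₁ := by
      push_cast
      linear_combination (-1 : ℂ) * h₁ + w₁ * r₁ * ζ * h
    have e2 : ((r₀ * k : ℝ) : ℂ) * w₂ * (v₀ - v₁) * ζ = v₁ - v₂ := by
      refine mul_right_cancel₀ d20 ?_
      push_cast
      linear_combination (-(v₁ - v₂)) * h₀ - w₂ * (v₁ - v₀) * r₀ * ζ * h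
    -- By `e1` and `e2` the point with parameter `r₁ * k` of the second arc is the one with
    -- parameter `r₀ * k` of the third.
    have hs1 : 0 < r₁ * k := mul_pos hr₁ hk
    have hs2 : 0 < r₀ * k := mul_pos hr₀ hk
    have hz := mem_image_of_mem (arcPoint v₁ v₂ w₁) (mem_Ioi.2 hs1)
    have ht := target_sub_arcPoint (p := v₁) (q := v₂) hw₁ hs1.le
    have hsrc := arcPoint_sub_source (p := v₁) (q := v₂) hw₁ hs1.le
    have hrel : arcPoint v₁ v₂ w₁ (r₁ * k) - v₁ =
        ((r₁ * k : ℝ) : ℂ) * w₁ * (v₂ - arcPoint v₁ v₂ w₁ (r₁ * k)) := by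
      rw [ht, hsrc]
      ring
    generalize arcPoint v₁ v₂ w₁ (r₁ * k) = z at hz hrel
    refine ⟨z, hz, r₀ * k, hs2, (eq_arcPoint_of_sub_eq hw₂ hs2.le ?_).symm⟩
    have f1 : (z - v₁) * (v₂ - v₀) * ζ = (v₀ - v₁) * (v₂ - z) := by
      rw [hrel, ← e1]
      ring
    have f2 : (z - v₂) * (v₀ - v₁) * ζ = (v₁ - v₂) * (v₀ - z) := by
      refine mul_left_cancel₀ hζ0 ?_
      linear_combination -f1 + (z - v₂) * (v₀ - v₁) * hζ
    refine mul_right_cancel₀ (mul_ne_zero d01 hζ0) ?_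
    linear_combination f2 - (v₀ - z) * e2

theorem exp_pi_div_three_quadratic : exp ((Real.pi / 3 : ℝ) * I) ^ 2 -
    exp ((Real.pi / 3 : ℝ) * I) + 1 = 0 := by
  have h : exp ((Real.pi / 3 : ℝ) * I) = 1 / 2 + (Real.sqrt 3 / 2 : ℝ) * I := by
    rw [exp_mul_I, ← ofReal_cos, ← ofReal_sin, Real.cos_pi_div_three, Real.sin_pi_div_three]
    push_cast
    ring
  have h3 : ((Real.sqrt 3 : ℝ) : ℂ) ^ 2 = 3 := by
    exact_mod_cast Real.sq_sqrt (by norm_num : (0 : ℝ) ≤ 3)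
  rw [h]
  push_cast
  linear_combination (Real.sqrt 3 : ℂ) ^ 2 / 4 * I_sq - 1 / 4 * h3

theorem exp_neg_pi_div_three_quadratic : exp ((-(Real.pi / 3) : ℝ) * I) ^ 2 -
    exp ((-(Real.pi / 3) : ℝ) * I) + 1 = 0 := by
  have h := exp_pi_div_three_quadratic
  have h0 := exp_ne_zero ((Real.pi / 3 : ℝ) * I)
  have e : exp ((-(Real.pi / 3) : ℝ) * I) = (exp ((Real.pi / 3 : ℝ) * I))⁻¹ := by
    rw [← exp_neg]; push_cast; ring_nf
  rw [e]
  field_simp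
  linear_combination h

namespace ArcTriangle

theorem false_of_exp_angle (T : ArcTriangle) {ζ : ℂ} (hζ : ζ ^ 2 - ζ + 1 = 0)
    (h0 : exp (T.angle 0 * I) = ζ) (h1 : exp (T.angle 1 * I) = ζ)
    (h2 : exp (T.angle 2 * I) = ζ⁻¹) : False := by
  have e1 : (0 + 1 : Fin 3) = 1 := by decide
  have e2 : (1 + 1 : Fin 3) = 2 := by decide
  have e3 : (2 + 1 : Fin 3) = 0 := by decide
  have d0 := T.dir_eq 0
  have d1 := T.dir_eq 1
  have d2 := T.dir_eq 2
  have n0 := T.v_ne 0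
  have n1 := T.v_ne 1
  have n2 := T.v_ne 2
  have p1 := T.inter_subset 1
  have q1 := T.v_notMem_opposite_edge 1
  unfold edge at q1
  rw [e1, e2, exp_add, h1, ← ofReal_exp] at d0
  rw [e2, e3, exp_add, h2, ← ofReal_exp] at d1
  rw [e3, e1, exp_add, h0, ← ofReal_exp] at d2
  rw [e1] at n0
  rw [e2] at n1
  rw [e3] at n2
  rw [e2, e3] at p1
  rw [e2, e3, e1] at q1
  rcases exists_crossing n0 n1 n2 (T.w_mem 0) (T.w_mem 1) (T.w_mem 2) (Real.exp_pos _)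
    (Real.exp_pos _) (Real.exp_pos _) hζ d2 d0 d1 with h | ⟨z, hz, hz'⟩
  · exact q1 h
  · exact (ne_of_mem_openArc n1 (T.w_mem 1) hz).2 (p1
      ⟨(mem_moebiusArc_iff n1 (T.w_mem 1)).2 (Or.inr (Or.inr hz)),
        (mem_moebiusArc_iff n2 (T.w_mem 2)).2 (Or.inr (Or.inr hz'))⟩)

end ArcTriangle

/-! ### The triangle of a drawing -/

/-- Unit vectors at the angle `ψ` span rays at the angle `ψ`. -/
theorem exists_eq_mul_exp {A B u u' : ℂ} {ψ : ℝ} (hA : ∃ r : ℝ, 0 < r ∧ u = r * A)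
    (hB : ∃ r : ℝ, 0 < r ∧ u' = r * B) (h : u' = u * exp (ψ * I)) :
    ∃ x : ℝ, B = A * exp (x + ψ * I) := by
  obtain ⟨r, hr, rfl⟩ := hA
  obtain ⟨r', hr', rfl⟩ := hB
  have h' : (r' : ℂ) ≠ 0 := by exact_mod_cast hr'.ne'
  refine ⟨Real.log (r / r'), ?_⟩
  rw [exp_add, ← ofReal_exp, Real.exp_log (div_pos hr hr')]
  refine mul_left_cancel₀ h' ?_
  rw [h]
  push_cast
  field_simp

/-- Subtraction in `Fin 6` computes the angle between two of six equally spaced directions. -/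
theorem exp_sixth_sub (θ : ℝ) (a b : Fin 6) :
    exp (((θ + 2 * Real.pi * ((b : ℕ) : ℝ) / 6 : ℝ) : ℂ) * I) =
      exp (((θ + 2 * Real.pi * ((a : ℕ) : ℝ) / 6 : ℝ) : ℂ) * I) *
        exp (((2 * Real.pi * (((b - a : Fin 6) : ℕ) : ℝ) / 6 : ℝ) : ℂ) * I) := by
  have key : b.val = a.val + (b - a).val ∨ b.val + 6 = a.val + (b - a).val := by
    revert a b
    decide
  rw [← exp_add]
  -- In the second case the subtraction wraps around, by a full turn.
  rcases key with h | h
  · rw [h]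
    push_cast
    ring_nf
  · rw [← exp_periodic]
    have h' : ((b : ℕ) : ℂ) + 6 = (a : ℕ) + ((b - a : Fin 6) : ℕ) := by exact_mod_cast h
    congr 1
    push_cast
    linear_combination (2 * Real.pi / 6 * I) * h'

theorem degree_inl (i : Fin 3) : hatCactus.degree (Sum.inl i) = 6 := by
  revert i
  decide

namespace LombardiDrawing

variable (D : LombardiDrawing hatCactus)

theorem succ_ne (i : Fin 3) : i ≠ i + 1 := by
  revert i
  decide

/-- The edge of the 3-cycle from vertex `i` to vertex `i + 1`. -/
def cycleEdge (i : Fin 3) : hatCactus.edgeSet :=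
  ⟨s(Sum.inl i, Sum.inl (i + 1)), succ_ne i⟩

/-- The edge from the cycle vertex `i` to its `k`-th pendant vertex. -/
def pendantEdge (i : Fin 3) (k : Fin 4) : hatCactus.edgeSet :=
  ⟨s(Sum.inl i, Sum.inr (i, k)), rfl⟩

theorem eq_cycleEdge_or {i : Fin 3} (e : hatCactus.edgeSet)
    (hi : Sum.inl (i + 1) ∈ (e : Sym2 (Fin 3 ⊕ (Fin 3 × Fin 4)))) :
    e = cycleEdge (i + 1) ∨ e = cycleEdge i ∨ ∃ k, e = pendantEdge (i + 1) k := by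
  obtain ⟨e, he⟩ := e
  obtain ⟨y, rfl⟩ := Sym2.mem_iff_exists.1 hi
  rcases y with j | ⟨j, k⟩
  · have h : i + 1 ≠ j := he
    have : j = i + 1 + 1 ∨ j = i := by
      clear he hi
      revert i j
      decide
    rcases this with rfl | rfl
    · exact Or.inl rfl
    · exact Or.inr (Or.inl (Subtype.ext Sym2.eq_swap))
  · have h : i + 1 = j := he
    subst h
    exact Or.inr (Or.inr ⟨k, rfl⟩)

theorem cycleCurve_eq : D.cycleCurve = ⋃ i, (D.arc (cycleEdge i)).carrier := by
  ext z
  simp only [cycleCurve, mem_iUnion]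
  constructor
  · rintro ⟨⟨e, he⟩, hv, hz⟩
    induction e using Sym2.ind with
    | _ x y =>
    obtain ⟨i, rfl⟩ := hv x (Sym2.mem_mk_left _ _)
    obtain ⟨j, rfl⟩ : ∃ j, i = j + 1 := ⟨i - 1, by simp⟩
    rcases eq_cycleEdge_or ⟨_, he⟩ (Sym2.mem_mk_left (Sum.inl (j + 1)) y) with h | h | ⟨k, h⟩
    · exact ⟨_, h ▸ hz⟩
    · exact ⟨_, h ▸ hz⟩
    · obtain ⟨l, hl⟩ := hv (Sum.inr (j + 1, k)) (by
        rw [h]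
        exact Sym2.mem_mk_right _ _)
      cases hl
  · rintro ⟨i, hz⟩
    refine ⟨cycleEdge i, ?_, hz⟩
    intro v hv
    rcases Sym2.mem_iff.1 hv with rfl | rfl
    · exact ⟨_, rfl⟩
    · exact ⟨_, rfl⟩

theorem exists_cycle_arc (i : Fin 3) : ∃ w ∈ slitPlane, (D.arc (cycleEdge i)).carrier =
      moebiusArc (D.pos (Sum.inl i)) (D.pos (Sum.inl (i + 1))) w ∧
    (∀ u, (D.arc (cycleEdge i)).LeavesInDirection (D.pos (Sum.inl i)) u →
      ∃ r : ℝ, 0 < r ∧ u = r * (w * (D.pos (Sum.inl (i + 1)) - D.pos (Sum.inl i)))) ∧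
    ∀ u, (D.arc (cycleEdge i)).LeavesInDirection (D.pos (Sum.inl (i + 1))) u →
      ∃ r : ℝ, 0 < r ∧ u = r * (w⁻¹ * (D.pos (Sum.inl i) - D.pos (Sum.inl (i + 1)))) :=
  (D.arc (cycleEdge i)).exists_moebiusArc_of_ends
    (fun h => succ_ne i (Sum.inl_injective (D.pos_injective h))) (D.endpoints (cycleEdge i))

theorem exists_pendant_arc (i : Fin 3) (k : Fin 4) :
    ∃ w ∈ slitPlane, (D.arc (pendantEdge i k)).carrier =
      moebiusArc (D.pos (Sum.inl i)) (D.pos (Sum.inr (i, k))) w ∧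
    ∀ u, (D.arc (pendantEdge i k)).LeavesInDirection (D.pos (Sum.inl i)) u →
      ∃ r : ℝ, 0 < r ∧ u = r * (w * (D.pos (Sum.inr (i, k)) - D.pos (Sum.inl i))) := by
  obtain ⟨w, h1, h2, h3, -⟩ := (D.arc (pendantEdge i k)).exists_moebiusArc_of_ends
    (fun h => Sum.inl_ne_inr (D.pos_injective h)) (D.endpoints (pendantEdge i k))
  exact ⟨w, h1, h2, h3⟩

/-- At a cycle vertex the six incident arcs leave in the directions `θ + 2πm / 6`, `m < 6`. -/
theorem exists_sixths (i : Fin 3) : ∃ (θ : ℝ)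
    (σ : {e : hatCactus.edgeSet // Sum.inl i ∈ (e : Sym2 (Fin 3 ⊕ (Fin 3 × Fin 4)))} ≃ Fin 6),
    ∀ e, (D.arc e.1).LeavesInDirection (D.pos (Sum.inl i))
      (exp (((θ + 2 * Real.pi * ((σ e : ℕ) : ℝ) / 6 : ℝ) : ℂ) * I)) := by
  obtain ⟨θ, σ, h⟩ := D.equally_spaced (Sum.inl i)
  refine ⟨θ, σ.trans (finCongr (degree_inl i)), fun e => ?_⟩
  have hcast : (hatCactus.degree (Sum.inl i) : ℝ) = 6 := by exact_mod_cast degree_inl i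
  have := h e
  rw [hcast] at this
  exact this

/-- Measured in sixths of a full turn from the outgoing cycle arc, the incoming cycle arc leaves at
some `j ≠ 0`, and each of the other positions `m` is taken by a pendant arc. -/
theorem exists_back_sixth (i : Fin 3) : ∃ j : Fin 6, j ≠ 0 ∧
    (∃ u u', (D.arc (cycleEdge (i + 1))).LeavesInDirection (D.pos (Sum.inl (i + 1))) u ∧
      (D.arc (cycleEdge i)).LeavesInDirection (D.pos (Sum.inl (i + 1))) u' ∧
      u' = u * exp (((2 * Real.pi * ((j : ℕ) : ℝ) / 6 : ℝ) : ℂ) * I)) ∧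
    ∀ m : Fin 6, m ≠ 0 → m ≠ j → ∃ k u u',
      (D.arc (cycleEdge (i + 1))).LeavesInDirection (D.pos (Sum.inl (i + 1))) u ∧
      (D.arc (pendantEdge (i + 1) k)).LeavesInDirection (D.pos (Sum.inl (i + 1))) u' ∧
      u' = u * exp (((2 * Real.pi * ((m : ℕ) : ℝ) / 6 : ℝ) : ℂ) * I) := by
  obtain ⟨θ, σ, h⟩ := D.exists_sixths (i + 1)
  let o : {e : hatCactus.edgeSet //
      Sum.inl (i + 1) ∈ (e : Sym2 (Fin 3 ⊕ (Fin 3 × Fin 4)))} :=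
    ⟨cycleEdge (i + 1), Sym2.mem_mk_left _ _⟩
  let b : {e : hatCactus.edgeSet //
      Sum.inl (i + 1) ∈ (e : Sym2 (Fin 3 ⊕ (Fin 3 × Fin 4)))} :=
    ⟨cycleEdge i, Sym2.mem_mk_right _ _⟩
  have hbo : b ≠ o := by
    intro hbo
    have h1 : s(Sum.inl i, Sum.inl (i + 1)) =
        (s(Sum.inl (i + 1), Sum.inl (i + 1 + 1)) : Sym2 (Fin 3 ⊕ (Fin 3 × Fin 4))) :=
      congrArg Subtype.val (congrArg Subtype.val hbo)
    clear * - h1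
    revert i
    decide
  refine ⟨σ b - σ o, sub_ne_zero.2 (fun h => hbo (σ.injective h)),
    ⟨_, _, h o, h b, exp_sixth_sub _ _ _⟩, fun m hm hmj => ?_⟩
  obtain ⟨e, he⟩ := σ.surjective (m + σ o)
  have hm' : m = σ e - σ o := by rw [he, add_sub_cancel_right]
  rcases eq_cycleEdge_or e.1 e.2 with h1 | h1 | ⟨k, h1⟩
  · have : e = o := Subtype.ext h1
    rw [this, sub_self] at hm'
    exact absurd hm' hm
  · have : e = b := Subtype.ext h1
    rw [this] at hm'
    exact absurd hm' hmj
  · refine ⟨k, _, _, h o, h1 ▸ h e, ?_⟩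
    rw [hm']
    exact exp_sixth_sub _ _ _

variable {D}

theorem cycleEdge_inter_subset (hD : D.IsPlanar) (i : Fin 3) :
    (D.arc (cycleEdge i)).carrier ∩ (D.arc (cycleEdge (i + 1))).carrier ⊆
      {D.pos (Sum.inl (i + 1))} := by
  have hne : cycleEdge i ≠ cycleEdge (i + 1) := by
    intro h
    have h1 : s(Sum.inl i, Sum.inl (i + 1)) =
        (s(Sum.inl (i + 1), Sum.inl (i + 1 + 1)) : Sym2 (Fin 3 ⊕ (Fin 3 × Fin 4))) :=
      congrArg Subtype.val h
    clear * - h1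
    revert i
    decide
  intro z hz
  obtain ⟨v, hv, hv', rfl⟩ := hD _ _ hne hz
  have : v = Sum.inl (i + 1) := by
    rcases Sym2.mem_iff.1 hv with rfl | rfl
    · rcases Sym2.mem_iff.1 hv' with h | h
      · exact h
      · exfalso
        have h1 : i = i + 1 + 1 := Sum.inl_injective h
        clear * - h1
        revert i
        decide
    · rfl
  rw [this]
  exact mem_singleton _

theorem pendantEdge_inter_subset (hD : D.IsPlanar) (i j : Fin 3) (k : Fin 4) :
    (D.arc (pendantEdge i k)).carrier ∩ (D.arc (cycleEdge j)).carrier ⊆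
      {D.pos (Sum.inl i)} := by
  have hmem : ∀ v, v ∈ (pendantEdge i k).1 → v ∈ (cycleEdge j).1 → v = Sum.inl i := by
    intro v hv hv'
    rcases Sym2.mem_iff.1 hv with rfl | rfl
    · rfl
    · rcases Sym2.mem_iff.1 hv' with h | h
      · cases h
      · cases h
  have hne : pendantEdge i k ≠ cycleEdge j := by
    intro h
    have := hmem (Sum.inr (i, k)) (Sym2.mem_mk_right _ _) (h ▸ Sym2.mem_mk_right _ _)
    cases this
  intro z hz
  obtain ⟨v, hv, hv', rfl⟩ := hD _ _ hne hz
  rw [hmem v hv hv']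
  exact mem_singleton _

/-- The 3-cycle of a planar drawing as a triangle of arcs: the angle at vertex `i` is `j i` sixths
of a full turn, and every other multiple of a sixth is the direction of a pendant arc. -/
theorem exists_arcTriangle (hD : D.IsPlanar) : ∃ (T : ArcTriangle) (j : Fin 3 → Fin 6),
    (∀ i, T.angle i = 2 * Real.pi * ((j i : ℕ) : ℝ) / 6) ∧ (∀ i, j i ≠ 0) ∧
    T.curve = D.cycleCurve ∧
    ∀ i (m : Fin 6), m ≠ 0 → m ≠ j i → ∃ k w, T.IsPendant i (D.pos (Sum.inr (i, k))) w ∧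
      ∃ x : ℝ, w * (D.pos (Sum.inr (i, k)) - T.v i) =
        T.dir i * exp (x + (2 * Real.pi * ((m : ℕ) : ℝ) / 6 : ℝ) * I) := by
  choose w hw hcar hout hback using D.exists_cycle_arc
  have hvertex : ∀ i : Fin 3, ∃ (j : Fin 6) (x : ℝ), j ≠ 0 ∧
      (w (i - 1))⁻¹ * (D.pos (Sum.inl (i - 1)) - D.pos (Sum.inl i)) =
        w i * (D.pos (Sum.inl (i + 1)) - D.pos (Sum.inl i)) *
          exp (x + (2 * Real.pi * ((j : ℕ) : ℝ) / 6 : ℝ) * I) ∧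
      ∀ m : Fin 6, m ≠ 0 → m ≠ j → ∃ k ω, ω ∈ slitPlane ∧
        (D.arc (pendantEdge i k)).carrier =
          moebiusArc (D.pos (Sum.inl i)) (D.pos (Sum.inr (i, k))) ω ∧
        ∃ x : ℝ, ω * (D.pos (Sum.inr (i, k)) - D.pos (Sum.inl i)) =
          w i * (D.pos (Sum.inl (i + 1)) - D.pos (Sum.inl i)) *
            exp (x + (2 * Real.pi * ((m : ℕ) : ℝ) / 6 : ℝ) * I) := by
    intro i
    obtain ⟨l, rfl⟩ : ∃ l, i = l + 1 := ⟨i - 1, by simp⟩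
    obtain ⟨j, hj, ⟨u, u', hu, hu', huu⟩, hp⟩ := D.exists_back_sixth l
    obtain ⟨x, hx⟩ := exists_eq_mul_exp (hout _ u hu) (hback _ u' hu') huu
    refine ⟨j, x, hj, by rw [add_sub_cancel_right]; exact hx, fun m hm hmj => ?_⟩
    obtain ⟨k, u, u', hu, hu', huu⟩ := hp m hm hmj
    obtain ⟨ω, hω, hcarω, houtω⟩ := D.exists_pendant_arc (l + 1) k
    exact ⟨k, ω, hω, hcarω, exists_eq_mul_exp (hout _ u hu) (houtω u' hu') huu⟩
  choose j x hj hx hp using hvertex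
  let T : ArcTriangle :=
    { v := fun i => D.pos (Sum.inl i)
      w := w
      scale := x
      angle := fun i => 2 * Real.pi * ((j i : ℕ) : ℝ) / 6
      v_injective := fun _ _ h => Sum.inl_injective (D.pos_injective h)
      w_mem := hw
      inter_subset := fun i => by
        rw [← hcar, ← hcar]
        exact cycleEdge_inter_subset hD i
      angle_mem := fun i => by
        have h1 : 0 < ((j i : ℕ) : ℝ) := by
          exact_mod_cast Nat.pos_of_ne_zero fun h => hj i (Fin.ext h)
        have h2 : ((j i : ℕ) : ℝ) < 6 := by exact_mod_cast (j i).isLt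
        have := Real.pi_pos
        constructor
        · positivity
        · rw [div_lt_iff₀ (by norm_num)]
          nlinarith
      dir_eq := fun i => by
        have := hx (i + 1)
        rwa [add_sub_cancel_right] at this }
  have hcurve : T.curve = D.cycleCurve := by
    rw [cycleCurve_eq]
    exact iUnion_congr fun i => (hcar i).symm
  refine ⟨T, j, fun _ => rfl, hj, hcurve, fun i m hm hmj => ?_⟩
  obtain ⟨k, ω, hω, hcarω, hdir⟩ := hp i m hm hmj
  have hne : D.pos (Sum.inl i) ≠ D.pos (Sum.inr (i, k)) := fun h =>
    Sum.inl_ne_inr (D.pos_injective h)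
  have havoid : ∀ z ∈ moebiusArc (D.pos (Sum.inl i)) (D.pos (Sum.inr (i, k))) ω,
      z ≠ D.pos (Sum.inl i) → z ∉ T.curve := by
    intro z hz hzne hzC
    rw [hcurve, cycleCurve_eq] at hzC
    obtain ⟨l, hl⟩ := mem_iUnion.1 hzC
    exact hzne (pendantEdge_inter_subset hD i l k ⟨hcarω ▸ hz, hl⟩)
  refine ⟨k, ω, ⟨hω, havoid _ (target_mem_moebiusArc _ _ _) hne.symm, fun z hz => ?_⟩, hdir⟩
  exact havoid z ((mem_moebiusArc_iff hne hω).2 (Or.inr (Or.inr hz)))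
    (ne_of_mem_openArc hne hω hz).1

end LombardiDrawing

theorem component_ne_of_outside_of_inside {C : Set ℂ} {y z : ℂ} (hy : y ∈ outsideCurve C)
    (hz : z ∈ insideCurve C) : connectedComponentIn Cᶜ y ≠ connectedComponentIn Cᶜ z :=
  fun h => hy.2 (h ▸ hz.2)

theorem sixth_lt {a b : ℕ} (h : a < b) :
    2 * Real.pi * (a : ℝ) / 6 < 2 * Real.pi * (b : ℝ) / 6 := by
  have h1 : (a : ℝ) < b := by exact_mod_cast h
  have := Real.two_pi_pos
  gcongr

theorem mainTheorem4 :
    ¬ ∃ D : LombardiDrawing hatCactus, D.IsPlanar ∧ D.HasBadHatEmbedding := by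
  rintro ⟨D, hD, hout0, hout1, hin2⟩
  obtain ⟨T, j, hangle, hj, hcurve, hpend⟩ := LombardiDrawing.exists_arcTriangle hD
  rw [← hcurve] at hout0 hout1 hin2
  have hj5 : ∀ i, 1 ≤ (j i : ℕ) ∧ (j i : ℕ) ≤ 5 := fun i =>
    ⟨Nat.pos_of_ne_zero fun h => hj i (Fin.ext h), Nat.le_of_lt_succ (j i).isLt⟩
  -- The position `1` is taken by a pendant arc on the left, unless it is the incoming arc.
  have hL : ∀ i, 2 ≤ (j i : ℕ) → ∃ k w, T.IsPendant i (D.pos (Sum.inr (i, k))) w ∧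
      T.LeavesLeft i (D.pos (Sum.inr (i, k))) w := by
    intro i hi
    obtain ⟨k, w, h1, x, h2⟩ := hpend i 1 (by decide) (fun h => by rw [← h] at hi; simp at hi)
    refine ⟨k, w, h1, x, _, ⟨?_, ?_⟩, h2⟩
    · simp [Real.pi_pos]
    · rw [hangle]
      exact sixth_lt hi
  -- The position `5` is taken by a pendant arc on the right, unless it is the incoming arc.
  have hR : ∀ i, (j i : ℕ) ≤ 4 → ∃ k w, T.IsPendant i (D.pos (Sum.inr (i, k))) w ∧
      T.LeavesRight i (D.pos (Sum.inr (i, k))) w := by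
    intro i hi
    obtain ⟨k, w, h1, x, h2⟩ := hpend i 5 (by decide) (fun h => by rw [← h] at hi; simp at hi)
    refine ⟨k, w, h1, x, _, ⟨?_, ?_⟩, h2⟩
    · rw [hangle]
      exact sixth_lt (Nat.lt_succ_of_le hi)
    · have := sixth_lt (show ((5 : Fin 6) : ℕ) < 6 by decide)
      push_cast at this ⊢
      linarith
  have hLout : 2 ≤ (j 0 : ℕ) ∨ 2 ≤ (j 1 : ℕ) → ∃ i q w, T.IsPendant i q w ∧
      T.LeavesLeft i q w ∧ q ∈ outsideCurve T.curve := by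
    rintro (h | h)
    · obtain ⟨k, w, h1, h2⟩ := hL 0 h
      exact ⟨_, _, _, h1, h2, hout0 k⟩
    · obtain ⟨k, w, h1, h2⟩ := hL 1 h
      exact ⟨_, _, _, h1, h2, hout1 k⟩
  have hRout : (j 0 : ℕ) ≤ 4 ∨ (j 1 : ℕ) ≤ 4 → ∃ i q w, T.IsPendant i q w ∧
      T.LeavesRight i q w ∧ q ∈ outsideCurve T.curve := by
    rintro (h | h)
    · obtain ⟨k, w, h1, h2⟩ := hR 0 h
      exact ⟨_, _, _, h1, h2, hout0 k⟩
    · obtain ⟨k, w, h1, h2⟩ := hR 1 h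
      exact ⟨_, _, _, h1, h2, hout1 k⟩
  -- The pendant arcs at the vertices `0` and `1` lie on one side, those at `2` on the other.
  have hLR : ¬ ((2 ≤ (j 0 : ℕ) ∨ 2 ≤ (j 1 : ℕ)) ∧ ((j 0 : ℕ) ≤ 4 ∨ (j 1 : ℕ) ≤ 4)) := by
    rintro ⟨h, h'⟩
    obtain ⟨_, _, _, h1, h2, h3⟩ := hLout h
    obtain ⟨_, _, _, h4, h5, h6⟩ := hRout h'
    exact h1.not_outside_both_sides h4 h2 h5 h3 h6
  have hL2 : ¬ ((2 ≤ (j 0 : ℕ) ∨ 2 ≤ (j 1 : ℕ)) ∧ 2 ≤ (j 2 : ℕ)) := by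
    rintro ⟨h, h'⟩
    obtain ⟨_, _, _, h1, h2, h3⟩ := hLout h
    obtain ⟨k, w, h4, h5⟩ := hL 2 h'
    exact component_ne_of_outside_of_inside h3 (hin2 k) (h1.component_eq_of_left h4 h2 h5)
  have hR2 : ¬ (((j 0 : ℕ) ≤ 4 ∨ (j 1 : ℕ) ≤ 4) ∧ (j 2 : ℕ) ≤ 4) := by
    rintro ⟨h, h'⟩
    obtain ⟨_, _, _, h1, h2, h3⟩ := hRout h
    obtain ⟨k, w, h4, h5⟩ := hR 2 h'
    exact component_ne_of_outside_of_inside h3 (hin2 k) (h1.component_eq_of_right h4 h2 h5)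
  have hone : exp ((2 * Real.pi * ((1 : ℕ) : ℝ) / 6 : ℝ) * I) =
      exp ((Real.pi / 3 : ℝ) * I) := by
    push_cast
    ring_nf
  have hfive : exp ((2 * Real.pi * ((5 : ℕ) : ℝ) / 6 : ℝ) * I) =
      exp ((-(Real.pi / 3) : ℝ) * I) := by
    rw [← exp_periodic ((-(Real.pi / 3) : ℝ) * I)]
    push_cast
    ring_nf
  have hinv : exp ((-(Real.pi / 3) : ℝ) * I) = (exp ((Real.pi / 3 : ℝ) * I))⁻¹ := by
    rw [← exp_neg]
    push_cast
    ring_nf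
  have := hj5 0
  have := hj5 1
  have := hj5 2
  have hcases : ((j 0 : ℕ) = 1 ∧ (j 1 : ℕ) = 1 ∧ (j 2 : ℕ) = 5) ∨
      ((j 0 : ℕ) = 5 ∧ (j 1 : ℕ) = 5 ∧ (j 2 : ℕ) = 1) := by omega
  rcases hcases with ⟨h0, h1, h2⟩ | ⟨h0, h1, h2⟩
  · refine T.false_of_exp_angle exp_pi_div_three_quadratic ?_ ?_ ?_
    · rw [hangle, h0, hone]
    · rw [hangle, h1, hone]
    · rw [hangle, h2, hfive, hinv]
  · refine T.false_of_exp_angle exp_neg_pi_div_three_quadratic ?_ ?_ ?_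
    · rw [hangle, h0, hfive]
    · rw [hangle, h1, hfive]
    · rw [hangle, h2, hone, hinv, inv_inv]
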